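/- Let $U\subset\mathbb R^n$ be a domain (nonempty, open, connected). Let $F$ be the field of meromorphic functions on $U$ (quotients of real analytic functions on $U$) and $\mathcal F\supset F$ the field of meromorphic functions of $x\in U$ and of finitely many of the real variables $\lambda^\alpha_k$, $\alpha=1,\dots,l$, $k=0,1,2,\dots$, with the derivation $\partial$ determined by $\partial x^i=0$, $\partial\lambda^\alpha_k=\lambda^\alpha_{k+1}$; write $\lambda^\alpha=\lambda^\alpha_0$. Let $\mathcal W$ be the space of vector fields $\sum_i w^i\,\partial/\partial x^i$ with $w^i\in\mathcal F$, with the commutator of vector fields in $x$ (the $\lambda^\alpha_k$ being parameters) and with $\partial$ acting on components. Let $V,Z_1,\dots,Z_l$ be meromorphic vector fields on $U$ (components in $F$), and consider the equations $$\dot x^i=V^i(x)+\lambda^\alpha Z^i_\alpha(x).\qquad(*)$$ Put $\mathcal Z=\mathrm{span}_{\mathcal F}\{Z_1,\dots,Z_l\}$ and $Dw=-\partial w-[V,w]-\lambda^\alpha[Z_\alpha,w]$ for $w\in\mathcal W$. Let $\mathcal Z_D=\mathrm{span}_{\mathcal F}\{D^mu : u\in\mathcal Z,\ m\ge 0\}$.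 Let $\mathcal Z_V=\bigcup_{k\ge0}\mathcal Z_V^k$, where $\mathcal Z_V^k$ is the Lie closure (the smallest $\mathcal F$-linear subspace of $\mathcal W$ that contains the set and is closed under the commutator) of $\bigcup_{m=0}^k(\mathrm{ad}_V)^m\mathcal Z$, $\mathrm{ad}_V=[V,\cdot\,]$. A gauge transformation of $(*)$ of order $p\ge 0$ is a transformation $\delta_\varepsilon x^i=\sum_{k=0}^{p}R^i_{p-k}\,\varepsilon^{(k)}$, $\delta_\varepsilon\lambda^\alpha=\sum_{k=0}^{p+1}U^\alpha_{p+1-k}\,\varepsilon^{(k)}$ with $R^i_k,U^\alpha_k\in\mathcal F$ (where $\lambda^\alpha_k$ stands for the $k$-th time derivative of $\lambda^\alpha$) such that $\delta_\varepsilon(\dot x^i-V^i-\lambda^\alpha Z^i_\alpha)$ vanishes on-shell, that is, after the velocities $\dot x^i$ are expressed from $(*)$, identically in $x,\lambda^\alpha,\dot\lambda^\alpha,\dots$ and for an arbitrary function $\varepsilon(t)$. Then: 1. $\mathcal Z_D=\mathcal Z_V$. 2. The vector fields $R_0,\dots,R_p\in\mathcal W$ of every gauge transformation of $(*)$ belong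 to $\mathcal Z_V$; moreover, the vector fields $R_k$ of all the gauge transformations, of all orders, span $\mathcal Z_V$ over $\mathcal F$. 3. Let $T_1,\dots,T_m\in F$ be constraints such that the system $(*)$, $T_a=0$ is in complete normal form on an open set $O\subset U$: $V,Z_\alpha,T_a$ are regular (have no poles) on $O$, and $VT_a=\sum_bF_a^bT_b$, $Z_\alpha T_a=\sum_bF_{\alpha a}^bT_b$ for some $F_a^b,F_{\alpha a}^b\in F$ that are regular on $O$. Then every gauge transformation of $(*)$ preserves the constraints: $\delta_\varepsilon T_a=\sum_j(\partial_jT_a)\,\delta_\varepsilon x^j$ vanishes on $\{x\in O: T_1=\dots=T_m=0\}$, that is, each coefficient of $\delta_\varepsilon T_a$ at $\varepsilon,\dot\varepsilon,\ddot\varepsilon,\dots$ has the value $0$ at every point $(x,\lambda,\dot\lambda,\dots)$ with $x$ in this set at which the structure functions $R^i_k,U^\alpha_k$ of the transformation are regular. -/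

import Mathlib

open Set

noncomputable section

namespace LocalDynamics

/-! ### Phase space and rings of analytic functions -/

/-- The phase space: a domain (nonempty, open and connected set) of `ℝⁿ`. -/
structure PhaseDomain (n : ℕ) where
  carrier : Set (Fin n → ℝ)
  isOpen : IsOpen carrier
  isConnected : IsConnected carrier

/-- Values `Λ k α` of the variables `λ^α_k`, `k = 0, 1, 2, …`; `λ_0 = λ` and `λ_k` stands for the
`k`-th time derivative of `λ`. -/
abbrev LamJet (l : ℕ) : Type := ℕ → Fin l → ℝ

/-- A point `(x, λ, λ', λ'', …)` with `x` in the phase space. -/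
abbrev JetPoint {n : ℕ} (U : PhaseDomain n) (l : ℕ) : Type := U.carrier × LamJet l

/-- The first `N` of the variables `λ_0, λ_1, …`. -/
def trunc {l : ℕ} (N : ℕ) (Λ : LamJet l) : Fin N → Fin l → ℝ := fun k => Λ k

/-- `g` is analytic and represents `f` as a function of `x` and `λ_0, …, λ_{N-1}`. -/
def Represents {n : ℕ} {U : PhaseDomain n} {l : ℕ} (f : JetPoint U l → ℝ) (N : ℕ)
    (g : (Fin n → ℝ) × (Fin N → Fin l → ℝ) → ℝ) : Prop :=
  AnalyticOnNhd ℝ g (U.carrier ×ˢ univ) ∧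
    ∀ q : JetPoint U l, f q = g ((q.1 : Fin n → ℝ), trunc N q.2)

/-- `f` is an analytic function of `x` and of a finite number of the variables `λ^α_k`. -/
def IsJetAnalytic {n : ℕ} {U : PhaseDomain n} {l : ℕ} (f : JetPoint U l → ℝ) : Prop :=
  ∃ N g, Represents f N g

theorem Represents.mono {n : ℕ} {U : PhaseDomain n} {l : ℕ} {f : JetPoint U l → ℝ} {N M : ℕ}
    {g : (Fin n → ℝ) × (Fin N → Fin l → ℝ) → ℝ} (h : Represents f N g) (hNM : N ≤ M) :
    Represents f M (fun q => g (q.1, fun k => q.2 (Fin.castLE hNM k))) := by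
  let L : ((Fin n → ℝ) × (Fin M → Fin l → ℝ)) →L[ℝ] ((Fin n → ℝ) × (Fin N → Fin l → ℝ)) :=
    (ContinuousLinearMap.fst ℝ _ _).prod
      (ContinuousLinearMap.pi fun k =>
        (ContinuousLinearMap.proj (R := ℝ) (φ := fun _ : Fin M => Fin l → ℝ)
          (Fin.castLE hNM k)).comp (ContinuousLinearMap.snd ℝ _ _))
  refine ⟨?_, fun q => h.2 q⟩
  have : AnalyticOnNhd ℝ (g ∘ L) (U.carrier ×ˢ univ) :=
    h.1.comp (L.analyticOnNhd _) (fun q hq => ⟨hq.1, mem_univ _⟩)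
  exact this

theorem IsJetAnalytic.common {n : ℕ} {U : PhaseDomain n} {l : ℕ} {f₁ f₂ : JetPoint U l → ℝ}
    (h₁ : IsJetAnalytic f₁) (h₂ : IsJetAnalytic f₂) :
    ∃ N g₁ g₂, Represents f₁ N g₁ ∧ Represents f₂ N g₂ := by
  obtain ⟨N₁, g₁, h₁⟩ := h₁
  obtain ⟨N₂, g₂, h₂⟩ := h₂
  exact ⟨max N₁ N₂, _, _, h₁.mono (le_max_left _ _), h₂.mono (le_max_right _ _)⟩

/-- The ring of analytic functions of `x ∈ U`. -/
def analyticRing {n : ℕ} (U : PhaseDomain n) : Subalgebra ℝ (U.carrier → ℝ) where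
  carrier := {f | ∃ g : (Fin n → ℝ) → ℝ, AnalyticOnNhd ℝ g U.carrier ∧ ∀ x : U.carrier, f x = g x}
  mul_mem' := by
    rintro f₁ f₂ ⟨g₁, h₁, e₁⟩ ⟨g₂, h₂, e₂⟩
    exact ⟨fun x => g₁ x * g₂ x, h₁.mul h₂, fun x => by simp [e₁, e₂]⟩
  add_mem' := by
    rintro f₁ f₂ ⟨g₁, h₁, e₁⟩ ⟨g₂, h₂, e₂⟩
    exact ⟨fun x => g₁ x + g₂ x, h₁.add h₂, fun x => by simp [e₁, e₂]⟩
  algebraMap_mem' := fun r => ⟨fun _ => r, analyticOnNhd_const, fun _ => rfl⟩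

/-- The ring of analytic functions of `x ∈ U` and of a finite number of the variables
`λ^α_k ∈ ℝ`. -/
def jetRing {n : ℕ} (U : PhaseDomain n) (l : ℕ) : Subalgebra ℝ (JetPoint U l → ℝ) where
  carrier := {f | IsJetAnalytic f}
  mul_mem' := by
    intro f₁ f₂ h₁ h₂
    obtain ⟨N, g₁, g₂, h₁, h₂⟩ := IsJetAnalytic.common h₁ h₂
    exact ⟨N, fun x => g₁ x * g₂ x, h₁.1.mul h₂.1, fun x => by simp [h₁.2, h₂.2]⟩
  add_mem' := by
    intro f₁ f₂ h₁ h₂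
    obtain ⟨N, g₁, g₂, h₁, h₂⟩ := IsJetAnalytic.common h₁ h₂
    exact ⟨N, fun x => g₁ x + g₂ x, h₁.1.add h₂.1, fun x => by simp [h₁.2, h₂.2]⟩
  algebraMap_mem' := fun r => ⟨0, fun _ => r, analyticOnNhd_const, fun _ => rfl⟩

/-- A function of `x` regarded as a function of `x` and the `λ^α_k`. -/
def pullback {n : ℕ} (U : PhaseDomain n) (l : ℕ) : analyticRing U →+* jetRing U l where
  toFun f := ⟨fun q => f.1 q.1, by
    obtain ⟨f, g, hg, e⟩ := f
    exact ⟨0, fun q => g q.1, hg.comp analyticOnNhd_fst (fun q hq => hq.1), fun q => e q.1⟩⟩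
  map_one' := rfl
  map_mul' _ _ := rfl
  map_zero' := rfl
  map_add' _ _ := rfl

theorem pullback_injective {n : ℕ} (U : PhaseDomain n) (l : ℕ) :
    Function.Injective (pullback U l) := by
  intro f g h
  apply Subtype.ext
  funext x
  exact congrFun (congrArg Subtype.val h) (x, 0)

instance jetRing_isDomain {n : ℕ} (U : PhaseDomain n) (l : ℕ) : IsDomain (jetRing U l) := by
  obtain ⟨x₀, hx₀⟩ := U.isConnected.nonempty
  have : Nontrivial (jetRing U l) := by
    refine ⟨0, 1, fun h => ?_⟩
    have := congrFun (congrArg Subtype.val h) (⟨x₀, hx₀⟩, 0)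
    simp at this
  have : NoZeroDivisors (jetRing U l) := by
    constructor
    intro f₁ f₂ h
    obtain ⟨N, g₁, g₂, h₁, h₂⟩ := IsJetAnalytic.common f₁.2 f₂.2
    have key : ∀ q ∈ U.carrier ×ˢ (univ : Set (Fin N → Fin l → ℝ)), ∃ p : JetPoint U l,
        q = ((p.1 : Fin n → ℝ), trunc N p.2) := by
      rintro ⟨x, v⟩ hq
      refine ⟨(⟨x, hq.1⟩, fun k => if h : k < N then v ⟨k, h⟩ else 0), ?_⟩
      simp only [Prod.mk.injEq, true_and]
      funext k
      simp [trunc]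
    have hmul : ∀ q ∈ U.carrier ×ˢ (univ : Set (Fin N → Fin l → ℝ)), g₁ q * g₂ q = 0 := by
      intro q hq
      obtain ⟨p, rfl⟩ := key q hq
      rw [← h₁.2, ← h₂.2]
      exact congrFun (congrArg Subtype.val h) p
    by_cases h0 : f₁ = 0
    · exact Or.inl h0
    right
    obtain ⟨p, hp⟩ : ∃ p, f₁.1 p ≠ 0 := by
      by_contra! hc
      exact h0 (Subtype.ext (funext hc))
    have hopen : IsOpen (U.carrier ×ˢ (univ : Set (Fin N → Fin l → ℝ))) := U.isOpen.prod isOpen_univ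
    have hp0 : ((p.1 : Fin n → ℝ), trunc N p.2) ∈
        U.carrier ×ˢ (univ : Set (Fin N → Fin l → ℝ)) := ⟨p.1.2, mem_univ _⟩
    rw [h₁.2] at hp
    have hev := (h₁.1 _ hp0).continuousAt.eventually_ne hp
    have hg₂ : g₂ =ᶠ[nhds ((p.1 : Fin n → ℝ), trunc N p.2)] 0 := by
      filter_upwards [hev, hopen.mem_nhds hp0] with q hq hqU
      exact (mul_eq_zero.1 (hmul q hqU)).resolve_left hq
    have hz := h₂.1.eqOn_zero_of_preconnected_of_eventuallyEq_zero
      (U.isConnected.isPreconnected.prod isPreconnected_univ) hp0 hg₂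
    apply Subtype.ext
    funext q
    rw [h₂.2]
    exact hz ⟨q.1.2, mem_univ _⟩
  exact NoZeroDivisors.to_isDomain _

instance analyticRing_isDomain {n : ℕ} (U : PhaseDomain n) : IsDomain (analyticRing U) :=
  (pullback_injective U 0).isDomain

/-! ### Fields of meromorphic functions -/

/-- The field of meromorphic functions of `x ∈ U`. -/
abbrev BaseField {n : ℕ} (U : PhaseDomain n) : Type := FractionRing (analyticRing U)

/-- The field of meromorphic functions of `x ∈ U` and of a finite number of the variables
`λ^α_k`. -/
abbrev JetField {n : ℕ} (U : PhaseDomain n) (l : ℕ) : Type := FractionRing (jetRing U l)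

/-- The inclusion of the meromorphic functions of `x` into those of `x` and the `λ^α_k`. -/
def baseInclusion {n : ℕ} (U : PhaseDomain n) (l : ℕ) : BaseField U →+* JetField U l :=
  IsFractionRing.map (pullback_injective U l)

/-- The variable `λ^α_k` as an element of the field. -/
def lamVar {n : ℕ} (U : PhaseDomain n) {l : ℕ} (k : ℕ) (α : Fin l) : JetField U l :=
  algebraMap (jetRing U l) (JetField U l) ⟨fun q => q.2 k α, k + 1, fun q => q.2 (Fin.last k) α, by
    let L : ((Fin n → ℝ) × (Fin (k + 1) → Fin l → ℝ)) →L[ℝ] ℝ :=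
      ((ContinuousLinearMap.proj (R := ℝ) (φ := fun _ : Fin l => ℝ) α).comp
        (ContinuousLinearMap.proj (R := ℝ) (φ := fun _ : Fin (k + 1) => Fin l → ℝ)
          (Fin.last k))).comp (ContinuousLinearMap.snd ℝ _ _)
    exact L.analyticOnNhd _, fun q => by simp [trunc]⟩

/-! ### The derivations `∂/∂xⁱ` and `∂` -/

open Classical in
/-- The extension of a function by zero outside the phase space (only used to write down
derivatives at points of the open set `U`). -/
def extendZero {n : ℕ} {U : PhaseDomain n} {l : ℕ} (f : JetPoint U l → ℝ)
    (x : Fin n → ℝ) (Λ : LamJet l) : ℝ :=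
  if h : x ∈ U.carrier then f (⟨x, h⟩, Λ) else 0

/-- The partial derivative `∂f/∂xⁱ`. -/
def partialX {n : ℕ} {U : PhaseDomain n} {l : ℕ} (i : Fin n) (f : JetPoint U l → ℝ) :
    JetPoint U l → ℝ := fun q =>
  deriv (fun t : ℝ => extendZero f ((q.1 : Fin n → ℝ) + t • Pi.single i 1) q.2) 0

/-- The shift `λ_k ↦ λ_{k+1}`. -/
def shift {l : ℕ} (Λ : LamJet l) : LamJet l := fun k => Λ (k + 1)

/-- `∂f = ∑_{k,α} λ^α_{k+1} ∂f/∂λ^α_k`, that is, the derivative of `f` in the direction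
`(0, λ_1, λ_2, …)`. -/
def partialT {n : ℕ} {U : PhaseDomain n} {l : ℕ} (f : JetPoint U l → ℝ) : JetPoint U l → ℝ :=
  fun q => deriv (fun t : ℝ => f (q.1, q.2 + t • shift q.2)) 0

theorem Represents.hasDerivAt_partialX {n : ℕ} {U : PhaseDomain n} {l : ℕ}
    {f : JetPoint U l → ℝ} {N : ℕ} {g : (Fin n → ℝ) × (Fin N → Fin l → ℝ) → ℝ}
    (h : Represents f N g) (i : Fin n) (q : JetPoint U l) :
    HasDerivAt (fun t : ℝ => extendZero f ((q.1 : Fin n → ℝ) + t • Pi.single i 1) q.2)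
      (fderiv ℝ g ((q.1 : Fin n → ℝ), trunc N q.2) (Pi.single i 1, 0)) 0 := by
  have hq : ((q.1 : Fin n → ℝ), trunc N q.2) ∈
      U.carrier ×ˢ (univ : Set (Fin N → Fin l → ℝ)) := ⟨q.1.2, mem_univ _⟩
  have hline : HasDerivAt (fun t : ℝ => ((q.1 : Fin n → ℝ) + t • (Pi.single i 1 : Fin n → ℝ)))
      (Pi.single i 1 : Fin n → ℝ) 0 := by
    simpa using ((hasDerivAt_id (0 : ℝ)).smul_const (Pi.single i 1 : Fin n → ℝ)).const_add
      (q.1 : Fin n → ℝ)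
  have hline2 : HasDerivAt (fun t : ℝ => ((q.1 : Fin n → ℝ) + t • (Pi.single i 1 : Fin n → ℝ),
      trunc N q.2)) ((Pi.single i 1 : Fin n → ℝ), (0 : Fin N → Fin l → ℝ)) 0 :=
    hline.prodMk (hasDerivAt_const _ _)
  have hg := (h.1 _ hq).differentiableAt.hasFDerivAt
  have hcomp := HasFDerivAt.comp_hasDerivAt_of_eq (0 : ℝ) hg hline2 (by simp)
  refine hcomp.congr_of_eventuallyEq ?_
  have hU : ∀ᶠ t : ℝ in nhds 0, (q.1 : Fin n → ℝ) + t • (Pi.single i 1 : Fin n → ℝ) ∈ U.carrier :=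
    hline.continuousAt.eventually_mem (U.isOpen.mem_nhds (by simp))
  filter_upwards [hU] with t ht
  simp [extendZero, ht, h.2]

theorem Represents.hasDerivAt_partialT {n : ℕ} {U : PhaseDomain n} {l : ℕ}
    {f : JetPoint U l → ℝ} {N : ℕ} {g : (Fin n → ℝ) × (Fin N → Fin l → ℝ) → ℝ}
    (h : Represents f N g) (q : JetPoint U l) :
    HasDerivAt (fun t : ℝ => f (q.1, q.2 + t • shift q.2))
      (fderiv ℝ g ((q.1 : Fin n → ℝ), trunc N q.2) (0, trunc N (shift q.2))) 0 := by
  have hq : ((q.1 : Fin n → ℝ), trunc N q.2) ∈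
      U.carrier ×ˢ (univ : Set (Fin N → Fin l → ℝ)) := ⟨q.1.2, mem_univ _⟩
  have hline : HasDerivAt (fun t : ℝ => trunc N q.2 + t • trunc N (shift q.2))
      (trunc N (shift q.2)) 0 := by
    simpa using ((hasDerivAt_id (0 : ℝ)).smul_const (trunc N (shift q.2))).const_add (trunc N q.2)
  have hline2 : HasDerivAt (fun t : ℝ => ((q.1 : Fin n → ℝ), trunc N q.2 + t • trunc N (shift q.2)))
      ((0 : Fin n → ℝ), trunc N (shift q.2)) 0 :=
    (hasDerivAt_const _ _).prodMk hline
  have hg := (h.1 _ hq).differentiableAt.hasFDerivAt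
  have hcomp := HasFDerivAt.comp_hasDerivAt_of_eq (0 : ℝ) hg hline2 (by simp)
  exact hcomp.congr_of_eventuallyEq (Filter.Eventually.of_forall fun t =>
    h.2 (q.1, q.2 + t • shift q.2))

theorem partialX_mem {n : ℕ} {U : PhaseDomain n} {l : ℕ} (i : Fin n) {f : JetPoint U l → ℝ}
    (hf : f ∈ jetRing U l) : partialX i f ∈ jetRing U l := by
  obtain ⟨N, g, h⟩ := hf
  refine ⟨N, fun q => fderiv ℝ g q (Pi.single i 1, 0), ?_, fun q => (h.hasDerivAt_partialX i q).deriv⟩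
  exact (ContinuousLinearMap.apply ℝ ℝ
    ((Pi.single i 1, 0) : (Fin n → ℝ) × (Fin N → Fin l → ℝ))).comp_analyticOnNhd h.1.fderiv

theorem partialT_mem {n : ℕ} {U : PhaseDomain n} {l : ℕ} {f : JetPoint U l → ℝ}
    (hf : f ∈ jetRing U l) : partialT f ∈ jetRing U l := by
  obtain ⟨N, g, h⟩ := hf
  let L₀ : ((Fin n → ℝ) × (Fin (N + 1) → Fin l → ℝ)) →L[ℝ] ((Fin n → ℝ) × (Fin N → Fin l → ℝ)) :=
    (ContinuousLinearMap.fst ℝ _ _).prod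
      (ContinuousLinearMap.pi fun k =>
        (ContinuousLinearMap.proj (R := ℝ) (φ := fun _ : Fin (N + 1) => Fin l → ℝ)
          k.castSucc).comp (ContinuousLinearMap.snd ℝ _ _))
  let L₁ : ((Fin n → ℝ) × (Fin (N + 1) → Fin l → ℝ)) →L[ℝ] ((Fin n → ℝ) × (Fin N → Fin l → ℝ)) :=
    (0 : _ →L[ℝ] (Fin n → ℝ)).prod
      (ContinuousLinearMap.pi fun k =>
        (ContinuousLinearMap.proj (R := ℝ) (φ := fun _ : Fin (N + 1) => Fin l → ℝ)
          k.succ).comp (ContinuousLinearMap.snd ℝ _ _))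
  refine ⟨N + 1, fun q => fderiv ℝ g (L₀ q) (L₁ q), ?_, fun q => (h.hasDerivAt_partialT q).deriv⟩
  have h₀ : AnalyticOnNhd ℝ (fun q => fderiv ℝ g (L₀ q)) (U.carrier ×ˢ univ) :=
    h.1.fderiv.comp (L₀.analyticOnNhd _) (fun q hq => ⟨hq.1, mem_univ _⟩)
  intro q hq
  exact ((ContinuousLinearMap.apply ℝ ℝ).flip.analyticAt_bilinear (fderiv ℝ g (L₀ q), L₁ q)).comp₂
    (h₀ q hq) (L₁.analyticAt q)

/-- `∂/∂xⁱ` as a derivation of the ring of analytic functions. -/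
def ringPartialX {n : ℕ} (U : PhaseDomain n) (l : ℕ) (i : Fin n) :
    Derivation ℝ (jetRing U l) (jetRing U l) :=
  Derivation.mk'
    { toFun := fun f => ⟨partialX i f.1, partialX_mem i f.2⟩
      map_add' := by
        intro f₁ f₂
        obtain ⟨N, g₁, g₂, h₁, h₂⟩ := IsJetAnalytic.common f₁.2 f₂.2
        apply Subtype.ext
        funext q
        have h₃ : Represents ((f₁ + f₂ : jetRing U l) : JetPoint U l → ℝ) N
            (fun x => g₁ x + g₂ x) := ⟨h₁.1.add h₂.1, fun x => by simp [h₁.2, h₂.2]⟩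
        have hq : ((q.1 : Fin n → ℝ), trunc N q.2) ∈
            U.carrier ×ˢ (univ : Set (Fin N → Fin l → ℝ)) := ⟨q.1.2, mem_univ _⟩
        have e : fderiv ℝ (fun x => g₁ x + g₂ x) ((q.1 : Fin n → ℝ), trunc N q.2) = _ :=
          fderiv_add (h₁.1 _ hq).differentiableAt (h₂.1 _ hq).differentiableAt
        change partialX i _ q = partialX i _ q + partialX i _ q
        simp only [partialX]
        rw [(h₁.hasDerivAt_partialX i q).deriv, (h₂.hasDerivAt_partialX i q).deriv,
          (h₃.hasDerivAt_partialX i q).deriv, e]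
        rfl
      map_smul' := by
        intro r f
        obtain ⟨N, g, h⟩ := f.2
        apply Subtype.ext
        funext q
        have h₃ : Represents ((r • f : jetRing U l) : JetPoint U l → ℝ) N
            (fun x => r • g x) :=
          ⟨(analyticOnNhd_const (v := r)).mul h.1, fun x => by simp [h.2]⟩
        have hq : ((q.1 : Fin n → ℝ), trunc N q.2) ∈
            U.carrier ×ˢ (univ : Set (Fin N → Fin l → ℝ)) := ⟨q.1.2, mem_univ _⟩
        have e : fderiv ℝ (fun x => r • g x) ((q.1 : Fin n → ℝ), trunc N q.2) = _ :=
          fderiv_const_smul (h.1 _ hq).differentiableAt r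
        change partialX i _ q = r • partialX i _ q
        simp only [partialX]
        rw [(h.hasDerivAt_partialX i q).deriv, (h₃.hasDerivAt_partialX i q).deriv, e]
        rfl }
    (by
      intro f₁ f₂
      obtain ⟨N, g₁, g₂, h₁, h₂⟩ := IsJetAnalytic.common f₁.2 f₂.2
      apply Subtype.ext
      funext q
      have h₃ : Represents ((f₁ * f₂ : jetRing U l) : JetPoint U l → ℝ) N
          (fun x => g₁ x * g₂ x) := ⟨h₁.1.mul h₂.1, fun x => by simp [h₁.2, h₂.2]⟩
      have hq : ((q.1 : Fin n → ℝ), trunc N q.2) ∈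
          U.carrier ×ˢ (univ : Set (Fin N → Fin l → ℝ)) := ⟨q.1.2, mem_univ _⟩
      have e : fderiv ℝ (fun x => g₁ x * g₂ x) ((q.1 : Fin n → ℝ), trunc N q.2) = _ :=
        fderiv_mul (h₁.1 _ hq).differentiableAt (h₂.1 _ hq).differentiableAt
      change partialX i _ q = f₁.1 q * partialX i _ q + f₂.1 q * partialX i _ q
      simp only [partialX]
      rw [(h₁.hasDerivAt_partialX i q).deriv, (h₂.hasDerivAt_partialX i q).deriv,
        (h₃.hasDerivAt_partialX i q).deriv, e, h₁.2, h₂.2]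
      rfl)

/-- `∂` as a derivation of the ring of analytic functions. -/
def ringPartialT {n : ℕ} (U : PhaseDomain n) (l : ℕ) :
    Derivation ℝ (jetRing U l) (jetRing U l) :=
  Derivation.mk'
    { toFun := fun f => ⟨partialT f.1, partialT_mem f.2⟩
      map_add' := by
        intro f₁ f₂
        obtain ⟨N₁, g₁, h₁⟩ := f₁.2
        obtain ⟨N₂, g₂, h₂⟩ := f₂.2
        apply Subtype.ext
        funext q
        exact deriv_fun_add (h₁.hasDerivAt_partialT q).differentiableAt
          (h₂.hasDerivAt_partialT q).differentiableAt
      map_smul' := by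
        intro r f
        obtain ⟨N, g, h⟩ := f.2
        apply Subtype.ext
        funext q
        exact deriv_fun_const_smul r (h.hasDerivAt_partialT q).differentiableAt }
    (by
      intro f₁ f₂
      obtain ⟨N₁, g₁, h₁⟩ := f₁.2
      obtain ⟨N₂, g₂, h₂⟩ := f₂.2
      apply Subtype.ext
      funext q
      have e := deriv_fun_mul (h₁.hasDerivAt_partialT q).differentiableAt
        (h₂.hasDerivAt_partialT q).differentiableAt
      change deriv (fun t : ℝ => f₁.1 (q.1, q.2 + t • shift q.2) *
        f₂.1 (q.1, q.2 + t • shift q.2)) 0 = f₁.1 q * partialT _ q + f₂.1 q * partialT _ q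
      rw [e]
      simp only [partialT, zero_smul, add_zero]
      ring)

theorem exists_derivation_localization {A K : Type*} [CommRing A] [Algebra ℝ A] [CommRing K]
    [Algebra A K] [Algebra ℝ K] [IsScalarTower ℝ A K] [IsLocalization (nonZeroDivisors A) K]
    (d : Derivation ℝ A A) :
    ∃ d' : Derivation ℝ K K, ∀ a : A, d' (algebraMap A K a) = algebraMap A K (d a) := by
  let φ : A →+* TrivSqZeroExt K K :=
    { toFun := fun a => TrivSqZeroExt.inl (algebraMap A K a) + TrivSqZeroExt.inr (algebraMap A K (d a))
      map_one' := by ext <;> simp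
      map_zero' := by ext <;> simp
      map_add' := fun a b => by
        rw [map_add, map_add, map_add, TrivSqZeroExt.inl_add, TrivSqZeroExt.inr_add]
        abel
      map_mul' := fun a b => by
        rw [Derivation.leibniz, smul_eq_mul, smul_eq_mul, map_mul, map_add, map_mul, map_mul]
        generalize algebraMap A K a = a
        generalize algebraMap A K b = b
        generalize algebraMap A K (d _) = a'
        generalize algebraMap A K (d _) = b'
        ext
        · simp
        · simp
          ring }
  have hφ₁ : ∀ a, (φ a).fst = algebraMap A K a := fun a => by
    change (TrivSqZeroExt.inl (algebraMap A K a) +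
      TrivSqZeroExt.inr (algebraMap A K (d a)) : TrivSqZeroExt K K).fst = _
    rw [TrivSqZeroExt.fst_add, TrivSqZeroExt.fst_inl, TrivSqZeroExt.fst_inr, add_zero]
  have hφ₂ : ∀ a, (φ a).snd = algebraMap A K (d a) := fun a => by
    change (TrivSqZeroExt.inl (algebraMap A K a) +
      TrivSqZeroExt.inr (algebraMap A K (d a)) : TrivSqZeroExt K K).snd = _
    rw [TrivSqZeroExt.snd_add, TrivSqZeroExt.snd_inl, TrivSqZeroExt.snd_inr, zero_add]
  have hφ : ∀ y : nonZeroDivisors A, IsUnit (φ y) := by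
    intro y
    rw [TrivSqZeroExt.isUnit_iff_isUnit_fst, hφ₁]
    exact IsLocalization.map_units K y
  let ψ : K →+* TrivSqZeroExt K K := IsLocalization.lift hφ
  have hψ : ∀ a, ψ (algebraMap A K a) = φ a := fun a => IsLocalization.lift_eq hφ a
  have hfst : ∀ k, (ψ k).fst = k := by
    have : (TrivSqZeroExt.fstHom K K K).toRingHom.comp ψ = RingHom.id K := by
      apply IsLocalization.ringHom_ext (nonZeroDivisors A)
      ext a
      simp [hψ, hφ₁]
    intro k
    exact congrArg (fun f : K →+* K => f k) this
  refine ⟨Derivation.mk' (LinearMap.mk (AddHom.mk (fun k => (ψ k).snd) (fun a b => by simp)) ?_)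
    ?_, ?_⟩
  · intro r k
    have hr : (ψ (algebraMap ℝ K r)).snd = 0 := by
      rw [IsScalarTower.algebraMap_apply ℝ A K r, hψ, hφ₂]
      simp
    simp [Algebra.smul_def, hfst, hr]
  · intro a b
    change (ψ (a * b)).snd = a * (ψ b).snd + b * (ψ a).snd
    rw [map_mul, TrivSqZeroExt.snd_mul, hfst, hfst, smul_eq_mul, op_smul_eq_mul, mul_comm b]
  · intro a
    change (ψ (algebraMap A K a)).snd = _
    rw [hψ, hφ₂]

/-- The (unique) extension of a derivation to the field of fractions. -/
def fractionDerivation {A : Type*} [CommRing A] [Algebra ℝ A] (d : Derivation ℝ A A) :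
    Derivation ℝ (FractionRing A) (FractionRing A) :=
  Classical.choose (exists_derivation_localization (K := FractionRing A) d)

theorem fractionDerivation_algebraMap {A : Type*} [CommRing A] [Algebra ℝ A]
    (d : Derivation ℝ A A) (a : A) :
    fractionDerivation d (algebraMap A (FractionRing A) a) =
      algebraMap A (FractionRing A) (d a) :=
  Classical.choose_spec (exists_derivation_localization (K := FractionRing A) d) a

/-- `∂/∂xⁱ` on meromorphic functions. -/
def dX {n : ℕ} (U : PhaseDomain n) (l : ℕ) (i : Fin n) :
    Derivation ℝ (JetField U l) (JetField U l) :=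
  fractionDerivation (ringPartialX U l i)

/-- `∂` on meromorphic functions: `∂xⁱ = 0` and `∂λ^α_k = λ^α_{k+1}`. -/
def dT {n : ℕ} (U : PhaseDomain n) (l : ℕ) : Derivation ℝ (JetField U l) (JetField U l) :=
  fractionDerivation (ringPartialT U l)

/-! ### Vector fields and distributions -/

/-- Meromorphic vector fields on `U`. -/
abbrev BaseVectorField {n : ℕ} (U : PhaseDomain n) : Type := Fin n → BaseField U

/-- Vector fields `∑ wⁱ ∂/∂xⁱ` on `U` whose components are meromorphic functions of `x` and of a
finite number of the variables `λ^α_k`. -/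
abbrev JetVectorField {n : ℕ} (U : PhaseDomain n) (l : ℕ) : Type := Fin n → JetField U l

/-- The inclusion of the meromorphic vector fields on `U`. -/
def BaseVectorField.toJet {n : ℕ} {U : PhaseDomain n} (l : ℕ) (v : BaseVectorField U) :
    JetVectorField U l := fun i => baseInclusion U l (v i)

/-- The derivative `w a = ∑ wⁱ ∂a/∂xⁱ` of a function along a vector field. -/
def lieDeriv {n : ℕ} {U : PhaseDomain n} {l : ℕ} (w : JetVectorField U l) (a : JetField U l) :
    JetField U l := ∑ i, w i * dX U l i a

/-- The commutator of vector fields (with the `λ^α_k` as parameters). -/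
def bracket {n : ℕ} {U : PhaseDomain n} {l : ℕ} (v w : JetVectorField U l) :
    JetVectorField U l := fun i => lieDeriv v (w i) - lieDeriv w (v i)

/-- A `λ`-distribution is involutive if it is closed with respect to the commutator. -/
def IsInvolutive {n : ℕ} {U : PhaseDomain n} {l : ℕ}
    (P : Submodule (JetField U l) (JetVectorField U l)) : Prop :=
  ∀ v ∈ P, ∀ w ∈ P, bracket v w ∈ P

/-- The Lie closure: the smallest involutive `λ`-distribution that contains `S`. -/
def lieClosure {n : ℕ} {U : PhaseDomain n} {l : ℕ} (S : Set (JetVectorField U l)) :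
    Submodule (JetField U l) (JetVectorField U l) :=
  sInf {P | S ⊆ P ∧ IsInvolutive P}

/-- The characteristic distribution, the span of the `Z_α`. -/
def charDistribution {n : ℕ} {U : PhaseDomain n} {l : ℕ} (Z : Fin l → BaseVectorField U) :
    Submodule (JetField U l) (JetVectorField U l) :=
  Submodule.span (JetField U l) (Set.range fun α => (Z α).toJet l)

/-- The `k`-th member of the filtration: the Lie closure of the union of
`𝒵, [V, 𝒵], …, [V, … [V, 𝒵]]` (at most `k` brackets with the drift `V`). -/
def gaugeFiltration {n : ℕ} {U : PhaseDomain n} {l : ℕ} (V : BaseVectorField U)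
    (Z : Fin l → BaseVectorField U) (k : ℕ) :
    Submodule (JetField U l) (JetVectorField U l) :=
  lieClosure (⋃ m ∈ Set.Iic k,
    (bracket (V.toJet l))^[m] '' (charDistribution Z : Set (JetVectorField U l)))

/-- The gauge distribution `𝒵_V`, the limit (union) of the increasing filtration. -/
def gaugeDistribution {n : ℕ} {U : PhaseDomain n} {l : ℕ} (V : BaseVectorField U)
    (Z : Fin l → BaseVectorField U) : Submodule (JetField U l) (JetVectorField U l) :=
  ⨆ k, gaugeFiltration V Z k

/-- The operator `D w = -∂w - [V, w] - ∑ λ^α [Z_α, w]`. -/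
def opD {n : ℕ} {U : PhaseDomain n} {l : ℕ} (V : BaseVectorField U)
    (Z : Fin l → BaseVectorField U) (w : JetVectorField U l) : JetVectorField U l :=
  -(fun i => dT U l (w i)) - bracket (V.toJet l) w
    - ∑ α, lamVar U 0 α • bracket ((Z α).toJet l) w

/-- The `λ`-distribution `𝒵_D`, the span of all `D^m u` with `u` in the characteristic
distribution. -/
def lambdaDistribution {n : ℕ} {U : PhaseDomain n} {l : ℕ} (V : BaseVectorField U)
    (Z : Fin l → BaseVectorField U) : Submodule (JetField U l) (JetVectorField U l) :=
  Submodule.span (JetField U l)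
    {w | ∃ u ∈ charDistribution Z, ∃ m : ℕ, w = (opD V Z)^[m] u}

/-! ### Gauge transformations of `ẋ = V + λ^α Z_α` -/

/-- Finite linear combinations `∑ c_k ε⁽ᵏ⁾` of an arbitrary function of time `ε` and of its time
derivatives, given by their coefficients. -/
abbrev EpsForm {n : ℕ} (U : PhaseDomain n) (l : ℕ) : Type := ℕ →₀ JetField U l

/-- The right hand side `V + λ^α Z_α` of the differential equations. -/
def velocity {n : ℕ} {U : PhaseDomain n} {l : ℕ} (V : BaseVectorField U)
    (Z : Fin l → BaseVectorField U) : JetVectorField U l :=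
  V.toJet l + ∑ α, lamVar U 0 α • (Z α).toJet l

/-- The time derivative of a function of `x, λ, λ', …` if the velocity `ẋ` is `v`. -/
def timeDeriv {n : ℕ} {U : PhaseDomain n} {l : ℕ} (v : JetVectorField U l) (a : JetField U l) :
    JetField U l := dT U l a + lieDeriv v a

/-- The time derivative of `∑ c_k ε⁽ᵏ⁾` if the velocity `ẋ` is `v`. -/
def epsTimeDeriv {n : ℕ} {U : PhaseDomain n} {l : ℕ} (v : JetVectorField U l) (c : EpsForm U l) :
    EpsForm U l :=
  c.sum fun k a => Finsupp.single k (timeDeriv v a) + Finsupp.single (k + 1) a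

/-- An infinitesimal transformation of order `p`:
`δx = ∑_{k=0}^{p} R_{p-k} ε⁽ᵏ⁾`, `δλ = ∑_{k=0}^{p+1} S_{p+1-k} ε⁽ᵏ⁾`. -/
structure Transformation {n : ℕ} (U : PhaseDomain n) (l p : ℕ) where
  R : Fin (p + 1) → JetVectorField U l
  S : Fin (p + 2) → Fin l → JetField U l

/-- The variation `δxⁱ`. -/
def Transformation.deltaX {n : ℕ} {U : PhaseDomain n} {l p : ℕ} (τ : Transformation U l p)
    (i : Fin n) : EpsForm U l := ∑ k : Fin (p + 1), Finsupp.single (k : ℕ) (τ.R k.rev i)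

/-- The variation `δλ^α`. -/
def Transformation.deltaLam {n : ℕ} {U : PhaseDomain n} {l p : ℕ} (τ : Transformation U l p)
    (α : Fin l) : EpsForm U l := ∑ k : Fin (p + 2), Finsupp.single (k : ℕ) (τ.S k.rev α)

/-- The on-shell variation
`δ(ẋⁱ - Vⁱ - λ^α Z_αⁱ) = d(δxⁱ)/dt - ∑_j ∂_j(Vⁱ + λ^α Z_αⁱ) δx^j - ∑_α Z_αⁱ δλ^α`
of the differential equations, the velocities in `d/dt` being expressed from these equations. -/
def Transformation.deltaEq {n : ℕ} {U : PhaseDomain n} {l p : ℕ} (τ : Transformation U l p)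
    (V : BaseVectorField U) (Z : Fin l → BaseVectorField U) (i : Fin n) : EpsForm U l :=
  epsTimeDeriv (velocity V Z) (τ.deltaX i)
    - ∑ j, dX U l j (velocity V Z i) • τ.deltaX j
    - ∑ α, (Z α).toJet l i • τ.deltaLam α

/-- The transformation is a gauge symmetry of `ẋ = V + λ^α Z_α`: the variation of the equations
vanishes on-shell for arbitrary `ε`. -/
def Transformation.IsGauge {n : ℕ} {U : PhaseDomain n} {l p : ℕ} (τ : Transformation U l p)
    (V : BaseVectorField U) (Z : Fin l → BaseVectorField U) : Prop :=
  ∀ i, τ.deltaEq V Z i = 0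

/-- The variation `δT = ∑_j ∂_j T δx^j` of a function of `x`. -/
def Transformation.deltaFun {n : ℕ} {U : PhaseDomain n} {l p : ℕ} (τ : Transformation U l p)
    (T : BaseField U) : EpsForm U l :=
  ∑ j, dX U l j (baseInclusion U l T) • τ.deltaX j

/-! ### Values of meromorphic functions and constrained systems in complete normal form -/

/-- The fraction `a` is regular at the point at which `ev` evaluates, and its value there is
`r`. -/
def FractionHasValue {A : Type*} [CommRing A] (ev : A →+* ℝ) (a : FractionRing A) (r : ℝ) : Prop :=
  ∃ f g : A, ev g ≠ 0 ∧
    a * algebraMap A (FractionRing A) g = algebraMap A (FractionRing A) f ∧ r = ev f / ev g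

/-- `a` is regular at `x` with value `r` there. -/
def BaseHasValue {n : ℕ} {U : PhaseDomain n} (x : U.carrier) (a : BaseField U) (r : ℝ) : Prop :=
  FractionHasValue ((Pi.evalRingHom (fun _ : U.carrier => ℝ) x).comp
    (analyticRing U).val.toRingHom) a r

/-- `a` is regular at `q = (x, λ, λ', …)` with value `r` there. -/
def JetHasValue {n : ℕ} {U : PhaseDomain n} {l : ℕ} (q : JetPoint U l) (a : JetField U l)
    (r : ℝ) : Prop :=
  FractionHasValue ((Pi.evalRingHom (fun _ : JetPoint U l => ℝ) q).comp
    (jetRing U l).val.toRingHom) a r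

/-- `a` has no pole at `x`. -/
def BaseRegularAt {n : ℕ} {U : PhaseDomain n} (x : U.carrier) (a : BaseField U) : Prop :=
  ∃ r, BaseHasValue x a r

/-- `a` has no pole at `q`. -/
def JetRegularAt {n : ℕ} {U : PhaseDomain n} {l : ℕ} (q : JetPoint U l) (a : JetField U l) :
    Prop := ∃ r, JetHasValue q a r

/-- The structure functions of the transformation have no pole at `q`. -/
def Transformation.RegularAt {n : ℕ} {U : PhaseDomain n} {l p : ℕ} (τ : Transformation U l p)
    (q : JetPoint U l) : Prop :=
  (∀ k i, JetRegularAt q (τ.R k i)) ∧ ∀ k α, JetRegularAt q (τ.S k α)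

/-- The system `ẋ = V + λ^α Z_α`, `T_a = 0` is in complete normal form on the open set `O ⊆ U`:
all data are regular on `O`, and `V T_a = F_a^b T_b`, `Z_α T_a = F_{αa}^b T_b` for some functions
`F_a^b`, `F_{αa}^b` that are regular on `O`. -/
structure IsCompleteNormalForm {n : ℕ} {U : PhaseDomain n} {l m : ℕ} (V : BaseVectorField U)
    (Z : Fin l → BaseVectorField U) (T : Fin m → BaseField U) (O : Set U.carrier) : Prop where
  isOpen : IsOpen O
  regular_V : ∀ x ∈ O, ∀ i, BaseRegularAt x (V i)
  regular_Z : ∀ x ∈ O, ∀ α i, BaseRegularAt x (Z α i)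
  regular_T : ∀ x ∈ O, ∀ a, BaseRegularAt x (T a)
  tangent_V : ∃ F : Fin m → Fin m → BaseField U, (∀ x ∈ O, ∀ a b, BaseRegularAt x (F a b)) ∧
    ∀ a, lieDeriv (V.toJet l) (baseInclusion U l (T a)) =
      ∑ b, baseInclusion U l (F a b) * baseInclusion U l (T b)
  tangent_Z : ∃ F : Fin l → Fin m → Fin m → BaseField U,
    (∀ x ∈ O, ∀ α a b, BaseRegularAt x (F α a b)) ∧
    ∀ α a, lieDeriv ((Z α).toJet l) (baseInclusion U l (T a)) =
      ∑ b, baseInclusion U l (F α a b) * baseInclusion U l (T b)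

/-- The part in `O` of the constraint surface `T_a = 0`. -/
def constraintSurface {n : ℕ} {U : PhaseDomain n} {m : ℕ} (T : Fin m → BaseField U)
    (O : Set U.carrier) : Set U.carrier := {x ∈ O | ∀ a, BaseHasValue x (T a) 0}

end LocalDynamics

end

open LocalDynamics

/-! Let `E = ∂ + [V + λ^α Z_α, ·]`, so that `D = -E`. It is additive, satisfies a Leibniz rule `E(f
w) = f E w + θ(f) w` for functions, and is a derivation of the commutator. Hence `𝒵_D` is the
smallest subspace that contains `𝒵` and is stable under `E`.

Equality of distributions. `𝒵_V` is involutive and stable under `ad_V`; it is also stable under `∂`,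
since `V` and `Z_α` do not depend on the `λ_k`. So it is stable under `E`, and `𝒵_D ⊆ 𝒵_V`. The
converse rests on the relations `[∂/∂λ^β_{k+1}, E] = ∂/∂λ^β_k` and `[∂/∂λ^β_0, E] = ad Z_β`
(`comp_L_succ_evol`, `comp_L_zero_evol`). Finitely many vector fields generate `𝒵_D`, and they
involve finitely many `λ_k`, so `∂/∂λ_k` preserves `𝒵_D` for large `k`. Descending with the first
relation, it does so for every `k`; the second then gives stability under `ad Z_β`. As `∂ = ∑
λ_{k+1} ∂/∂λ_k`, stability under `∂` and then under `ad_V` follows. Involutivity is propagated from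
the `Z_α` by `[E v, w] = E[v, w] - [v, E w]`.

Gauge transformations. Comparing coefficients of `ε⁽ᵏ⁾`, the gauge condition says that `R_0 ∈ 𝒵`,
`R_{j+1} ∈ D R_j + 𝒵`, and that this chain may be continued by `R_{p+1} = 0`. So all `R_j` lie in
`𝒵_D`. Conversely, the `k`-th members of chains form an increasing sequence of subspaces, which
stabilises at some `N` and then equals `𝒵_D`. A chain through a given vector field at place `N` can
thus be terminated by adding a delayed chain that cancels its later value (`exists_chain`).

Constraints. Over the differential ring of fractions regular at the given point, the span of the
`T_a` is stable under `∂`, `V` and `Z_α`. The recursion for the `R_j` shows by induction that each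
`R_j T_a` lies in this span, whose elements vanish at the point.

The algebra is carried out in an abstract `JetCalculus`, which is built on analytic functions and
then transferred to fractions. -/

noncomputable section

namespace LocalDynamics

/-! ### The derivations `∂/∂λ^α_k` -/

section RingLevel

variable {n l : ℕ} {U : PhaseDomain n}

/-- The unit vector in the direction of `λ^α_k`. -/
def lamUnit (k : ℕ) (α : Fin l) : LamJet l := Pi.single k (Pi.single α 1)

/-- The partial derivative `∂f/∂λ^α_k`. -/
def partialLam (k : ℕ) (α : Fin l) (f : JetPoint U l → ℝ) : JetPoint U l → ℝ :=
  fun q => deriv (fun t : ℝ => f (q.1, q.2 + t • lamUnit k α)) 0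

theorem Represents.hasDerivAt_partialLam
    {f : JetPoint U l → ℝ} {N : ℕ} {g : (Fin n → ℝ) × (Fin N → Fin l → ℝ) → ℝ}
    (h : Represents f N g) (k : ℕ) (α : Fin l) (q : JetPoint U l) :
    HasDerivAt (fun t : ℝ => f (q.1, q.2 + t • lamUnit k α))
      (fderiv ℝ g ((q.1 : Fin n → ℝ), trunc N q.2) (0, trunc N (lamUnit k α))) 0 := by
  have hq : ((q.1 : Fin n → ℝ), trunc N q.2) ∈
      U.carrier ×ˢ (univ : Set (Fin N → Fin l → ℝ)) := ⟨q.1.2, mem_univ _⟩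
  have hline : HasDerivAt (fun t : ℝ => trunc N q.2 + t • trunc N (lamUnit k α))
      (trunc N (lamUnit k α)) 0 := by
    simpa using
      ((hasDerivAt_id (0 : ℝ)).smul_const (trunc N (lamUnit k α))).const_add (trunc N q.2)
  have hline2 : HasDerivAt
      (fun t : ℝ => ((q.1 : Fin n → ℝ), trunc N q.2 + t • trunc N (lamUnit k α)))
      ((0 : Fin n → ℝ), trunc N (lamUnit k α)) 0 :=
    (hasDerivAt_const _ _).prodMk hline
  have hg := (h.1 _ hq).differentiableAt.hasFDerivAt
  have hcomp := HasFDerivAt.comp_hasDerivAt_of_eq (0 : ℝ) hg hline2 (by simp)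
  exact hcomp.congr_of_eventuallyEq (Filter.Eventually.of_forall fun t =>
    h.2 (q.1, q.2 + t • lamUnit k α))

theorem Represents.partialLam {f : JetPoint U l → ℝ} {N : ℕ}
    {g : (Fin n → ℝ) × (Fin N → Fin l → ℝ) → ℝ} (h : Represents f N g) (k : ℕ) (α : Fin l) :
    Represents (partialLam k α f) N (fun q => fderiv ℝ g q (0, trunc N (lamUnit k α))) :=
  ⟨(ContinuousLinearMap.apply ℝ ℝ
    ((0, trunc N (lamUnit k α)) : (Fin n → ℝ) × (Fin N → Fin l → ℝ))).comp_analyticOnNhd h.1.fderiv,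
    fun q => (h.hasDerivAt_partialLam k α q).deriv⟩

theorem Represents.partialX {f : JetPoint U l → ℝ} {N : ℕ}
    {g : (Fin n → ℝ) × (Fin N → Fin l → ℝ) → ℝ} (h : Represents f N g) (i : Fin n) :
    Represents (partialX i f) N (fun q => fderiv ℝ g q (Pi.single i 1, 0)) :=
  ⟨(ContinuousLinearMap.apply ℝ ℝ
    ((Pi.single i 1, 0) : (Fin n → ℝ) × (Fin N → Fin l → ℝ))).comp_analyticOnNhd h.1.fderiv,
    fun q => (h.hasDerivAt_partialX i q).deriv⟩

/-- `∂/∂λ^α_k` as a derivation of the ring of analytic functions. -/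
def ringPartialLam (U : PhaseDomain n) (k : ℕ) (α : Fin l) :
    Derivation ℝ (jetRing U l) (jetRing U l) :=
  Derivation.mk'
    { toFun := fun f => ⟨partialLam k α f.1, by
        obtain ⟨N, g, h⟩ := f.2
        exact ⟨N, _, h.partialLam k α⟩⟩
      map_add' := by
        intro f₁ f₂
        obtain ⟨N₁, g₁, h₁⟩ := f₁.2
        obtain ⟨N₂, g₂, h₂⟩ := f₂.2
        apply Subtype.ext
        funext q
        exact deriv_fun_add (h₁.hasDerivAt_partialLam k α q).differentiableAt
          (h₂.hasDerivAt_partialLam k α q).differentiableAt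
      map_smul' := by
        intro r f
        obtain ⟨N, g, h⟩ := f.2
        apply Subtype.ext
        funext q
        exact deriv_fun_const_smul r (h.hasDerivAt_partialLam k α q).differentiableAt }
    (by
      intro f₁ f₂
      obtain ⟨N₁, g₁, h₁⟩ := f₁.2
      obtain ⟨N₂, g₂, h₂⟩ := f₂.2
      apply Subtype.ext
      funext q
      have e := deriv_fun_mul (h₁.hasDerivAt_partialLam k α q).differentiableAt
        (h₂.hasDerivAt_partialLam k α q).differentiableAt
      change deriv (fun t : ℝ => f₁.1 (q.1, q.2 + t • lamUnit k α) *
        f₂.1 (q.1, q.2 + t • lamUnit k α)) 0 =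
          f₁.1 q * partialLam k α _ q + f₂.1 q * partialLam k α _ q
      rw [e]
      simp only [partialLam, zero_smul, add_zero]
      ring)

/-! ### Commutation relations of the derivations on analytic functions -/

theorem fderiv_fderiv_apply_comm {E : Type*} [NormedAddCommGroup E] [NormedSpace ℝ E]
    {g : E → ℝ} {p : E} (hg : AnalyticAt ℝ g p) (u v : E) :
    fderiv ℝ (fun q => fderiv ℝ g q u) p v = fderiv ℝ (fun q => fderiv ℝ g q v) p u := by
  have hd : DifferentiableAt ℝ (fderiv ℝ g) p := hg.fderiv.differentiableAt
  have e : ∀ w z : E, fderiv ℝ (fun q => fderiv ℝ g q w) p z = fderiv ℝ (fderiv ℝ g) p z w := by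
    intro w z
    rw [fderiv_clm_apply hd (differentiableAt_const w)]
    simp
  rw [e, e]
  have hs : IsSymmSndFDerivAt ℝ g p := (hg.contDiffAt (n := ⊤)).isSymmSndFDerivAt (by simp)
  exact hs v u

theorem mem_jetDomain (N : ℕ) (q : JetPoint U l) : ((q.1 : Fin n → ℝ), trunc N q.2) ∈
    U.carrier ×ˢ (univ : Set (Fin N → Fin l → ℝ)) := ⟨q.1.2, mem_univ _⟩

theorem ringPartialX_comm (i j : Fin n) (f : jetRing U l) :
    ringPartialX U l i (ringPartialX U l j f) = ringPartialX U l j (ringPartialX U l i f) := by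
  obtain ⟨N, g, h⟩ := f.2
  apply Subtype.ext
  funext q
  change partialX i (partialX j f.1) q = partialX j (partialX i f.1) q
  rw [((h.partialX j).partialX i).2, ((h.partialX i).partialX j).2]
  exact fderiv_fderiv_apply_comm (h.1 _ (mem_jetDomain N q)) _ _

theorem ringPartialX_ringPartialLam (i : Fin n) (k : ℕ) (α : Fin l) (f : jetRing U l) :
    ringPartialX U l i (ringPartialLam U k α f) = ringPartialLam U k α (ringPartialX U l i f) := by
  obtain ⟨N, g, h⟩ := f.2
  apply Subtype.ext
  funext q
  change partialX i (partialLam k α f.1) q = partialLam k α (partialX i f.1) q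
  rw [((h.partialLam k α).partialX i).2, ((h.partialX i).partialLam k α).2]
  exact fderiv_fderiv_apply_comm (h.1 _ (mem_jetDomain N q)) _ _

theorem ringPartialLam_comm (k j : ℕ) (α β : Fin l) (f : jetRing U l) :
    ringPartialLam U k α (ringPartialLam U j β f) =
      ringPartialLam U j β (ringPartialLam U k α f) := by
  obtain ⟨N, g, h⟩ := f.2
  apply Subtype.ext
  funext q
  change partialLam k α (partialLam j β f.1) q = partialLam j β (partialLam k α f.1) q
  rw [((h.partialLam j β).partialLam k α).2, ((h.partialLam k α).partialLam j β).2]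
  exact fderiv_fderiv_apply_comm (h.1 _ (mem_jetDomain N q)) _ _

/-- `f` does not depend on `λ_k` with `k ≥ N`. -/
def HasOrderLE (f : jetRing U l) (N : ℕ) : Prop := ∃ g, Represents f.1 N g

theorem exists_hasOrderLE (f : jetRing U l) : ∃ N, HasOrderLE f N := f.2

theorem HasOrderLE.mono {f : jetRing U l} {N M : ℕ} (h : HasOrderLE f N) (hNM : N ≤ M) :
    HasOrderLE f M := let ⟨_, hg⟩ := h; ⟨_, hg.mono hNM⟩

theorem HasOrderLE.ringPartialX {f : jetRing U l} {N : ℕ} (h : HasOrderLE f N) (i : Fin n) :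
    HasOrderLE (ringPartialX U l i f) N := let ⟨_, hg⟩ := h; ⟨_, hg.partialX i⟩

theorem HasOrderLE.ringPartialLam {f : jetRing U l} {N : ℕ} (h : HasOrderLE f N) (k : ℕ)
    (α : Fin l) : HasOrderLE (ringPartialLam U k α f) N := let ⟨_, hg⟩ := h; ⟨_, hg.partialLam k α⟩

theorem HasOrderLE.ringPartialLam_eq_zero {f : jetRing U l} {N : ℕ} (h : HasOrderLE f N) {k : ℕ}
    (hk : N ≤ k) (α : Fin l) : LocalDynamics.ringPartialLam U k α f = 0 := by
  obtain ⟨g, h⟩ := h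
  apply Subtype.ext
  funext q
  change LocalDynamics.partialLam k α f.1 q = 0
  rw [(h.partialLam k α).2]
  have : trunc N (lamUnit k α) = 0 := by
    funext j
    have : (j : ℕ) ≠ k := by omega
    simp [trunc, lamUnit, this]
  rw [this]
  exact map_zero _

/-- The variable `λ^α_k` as an analytic function. -/
def ringLam (U : PhaseDomain n) (k : ℕ) (α : Fin l) : jetRing U l :=
  ⟨fun q => q.2 k α, k + 1, fun q => q.2 (Fin.last k) α, by
    let L : ((Fin n → ℝ) × (Fin (k + 1) → Fin l → ℝ)) →L[ℝ] ℝ :=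
      ((ContinuousLinearMap.proj (R := ℝ) (φ := fun _ : Fin l => ℝ) α).comp
        (ContinuousLinearMap.proj (R := ℝ) (φ := fun _ : Fin (k + 1) => Fin l → ℝ)
          (Fin.last k))).comp (ContinuousLinearMap.snd ℝ _ _)
    exact L.analyticOnNhd _, fun q => by simp [trunc]⟩

theorem ringPartialX_ringLam (i : Fin n) (k : ℕ) (α : Fin l) :
    ringPartialX U l i (ringLam U k α) = 0 := by
  apply Subtype.ext
  funext q
  change deriv (fun t : ℝ => extendZero (ringLam U k α).1
    ((q.1 : Fin n → ℝ) + t • Pi.single i 1) q.2) 0 = 0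
  -- For small `t` the line stays in the open set `U`, so the zero values of `extendZero` outside
  -- `U` do not affect the derivative.
  have hc : Filter.Tendsto (fun t : ℝ => (q.1 : Fin n → ℝ) + t • (Pi.single i 1 : Fin n → ℝ))
      (nhds 0) (nhds (q.1 : Fin n → ℝ)) := by
    have : Continuous fun t : ℝ => (q.1 : Fin n → ℝ) + t • (Pi.single i 1 : Fin n → ℝ) := by
      fun_prop
    simpa using this.tendsto 0
  have : (fun t : ℝ => extendZero (ringLam U k α).1
      ((q.1 : Fin n → ℝ) + t • Pi.single i 1) q.2) =ᶠ[nhds 0] fun _ => q.2 k α := by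
    filter_upwards [hc.eventually_mem (U.isOpen.mem_nhds q.1.2)] with t ht
    simp [extendZero, ht, ringLam]
  rw [this.deriv_eq, deriv_const]

theorem ringPartialLam_ringLam (j k : ℕ) (β α : Fin l) :
    ringPartialLam U j β (ringLam U k α) = if j = k ∧ β = α then 1 else 0 := by
  apply Subtype.ext
  funext q
  change deriv (fun t : ℝ => (q.2 + t • lamUnit j β) k α) 0 = _
  have : (fun t : ℝ => (q.2 + t • lamUnit j β) k α) =
      fun t => q.2 k α + t * lamUnit j β k α := by
    funext t; simp
  rw [this, deriv_const_add, deriv_mul_const (differentiableAt_id), deriv_id'', one_mul]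
  by_cases hjk : j = k
  · subst hjk
    by_cases hαβ : β = α
    · subst hαβ; simp [lamUnit]
    · simp [lamUnit, hαβ, Ne.symm hαβ]
  · simp [lamUnit, hjk, Ne.symm hjk]

theorem HasOrderLE.ringPartialT_eq {f : jetRing U l} {N : ℕ} (h : HasOrderLE f N) :
    ringPartialT U l f =
      ∑ k ∈ Finset.range N, ∑ α, ringLam U (k + 1) α * LocalDynamics.ringPartialLam U k α f := by
  obtain ⟨g, h⟩ := h
  apply Subtype.ext
  funext q
  have e : (∑ k ∈ Finset.range N, ∑ α,
      ringLam U (k + 1) α * LocalDynamics.ringPartialLam U k α f : jetRing U l).1 q =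
      ∑ k ∈ Finset.range N, ∑ α, q.2 (k + 1) α * LocalDynamics.partialLam k α f.1 q := by
    simp only [AddSubmonoidClass.coe_finsetSum, Finset.sum_apply]
    rfl
  rw [e]
  change partialT f.1 q = _
  rw [partialT, (h.hasDerivAt_partialT q).deriv]
  -- The direction `(λ_1, …, λ_N)` of `∂`, expanded in unit vectors; linearity of `fderiv` then
  -- gives the chain rule.
  have key : ((0, trunc N (shift q.2)) : (Fin n → ℝ) × (Fin N → Fin l → ℝ)) =
      ∑ k ∈ Finset.range N, ∑ α, q.2 (k + 1) α •
        ((0, trunc N (lamUnit k α)) : (Fin n → ℝ) × (Fin N → Fin l → ℝ)) := by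
    refine Prod.ext ?_ ?_
    · simp [Prod.fst_sum]
    · simp only [Prod.snd_sum, Prod.smul_snd]
      funext j β
      simp only [Finset.sum_apply, Pi.smul_apply, trunc, lamUnit, shift, smul_eq_mul]
      rw [Finset.sum_eq_single (j : ℕ), Finset.sum_eq_single β]
      · simp
      · intro α _ hα; simp [hα.symm]
      · simp
      · intro k _ hk
        refine Finset.sum_eq_zero fun α _ => ?_
        simp [hk.symm]
      · intro hj; exact absurd (Finset.mem_range.2 j.2) hj
  rw [key, map_sum]
  refine Finset.sum_congr rfl fun k _ => ?_
  rw [map_sum]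
  refine Finset.sum_congr rfl fun α _ => ?_
  rw [map_smul, (h.partialLam k α).2]
  rfl

theorem ringPartialX_ringPartialT (i : Fin n) (f : jetRing U l) :
    ringPartialX U l i (ringPartialT U l f) = ringPartialT U l (ringPartialX U l i f) := by
  obtain ⟨N, h⟩ := exists_hasOrderLE f
  rw [h.ringPartialT_eq, (h.ringPartialX i).ringPartialT_eq]
  simp only [map_sum, Derivation.leibniz, ringPartialX_ringLam, smul_eq_mul, mul_zero,
    add_zero, ringPartialX_ringPartialLam]

/-- In `∂ = ∑ λ_{j+1} ∂/∂λ_j` only the coefficient with `j = k` depends on `λ_{k+1}`;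
differentiating it produces the extra term. No coefficient depends on `λ_0`, so the corresponding
relation for `λ_0` has no such term. -/
theorem ringPartialLam_succ_ringPartialT (k : ℕ) (β : Fin l) (f : jetRing U l) :
    ringPartialLam U (k + 1) β (ringPartialT U l f) =
      ringPartialT U l (ringPartialLam U (k + 1) β f) + ringPartialLam U k β f := by
  obtain ⟨N, h⟩ := exists_hasOrderLE f
  -- The order bound is raised above `k`, so that the term with index `k` is present in the sum.
  replace h := h.mono (le_max_left N (k + 1))
  have hk : k ∈ Finset.range (max N (k + 1)) := Finset.mem_range.2 (by omega)
  rw [h.ringPartialT_eq, (h.ringPartialLam (k + 1) β).ringPartialT_eq]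
  simp only [map_sum, Derivation.leibniz, ringPartialLam_ringLam, smul_eq_mul,
    Finset.sum_add_distrib, ringPartialLam_comm _ (k + 1)]
  congr 1
  rw [Finset.sum_eq_single k, Finset.sum_eq_single β]
  · simp
  · intro α _ hα; simp [hα.symm]
  · simp
  · intro j _ hj; simp [hj.symm]
  · intro h; exact absurd hk h

theorem ringPartialLam_zero_ringPartialT (β : Fin l) (f : jetRing U l) :
    ringPartialLam U 0 β (ringPartialT U l f) = ringPartialT U l (ringPartialLam U 0 β f) := by
  obtain ⟨N, h⟩ := exists_hasOrderLE f
  rw [h.ringPartialT_eq, (h.ringPartialLam 0 β).ringPartialT_eq]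
  simp only [map_sum, Derivation.leibniz, ringPartialLam_ringLam, smul_eq_mul,
    ringPartialLam_comm _ 0]
  simp

theorem ringPartialT_pullback (f : analyticRing U) : ringPartialT U l (pullback U l f) = 0 := by
  apply Subtype.ext
  funext q
  exact deriv_const 0 (f.1 q.1)

theorem ringPartialLam_pullback (k : ℕ) (α : Fin l) (f : analyticRing U) :
    ringPartialLam U k α (pullback U l f) = 0 := by
  apply Subtype.ext
  funext q
  exact deriv_const 0 (f.1 q.1)

end RingLevel

/-! ### Differential rings with the derivations `∂/∂xⁱ`, `∂`, `∂/∂λ^α_k` -/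

/-- A ring with commuting derivations `X i = ∂/∂xⁱ`, the derivation `T = ∂`, elements
`lam k α = λ^α_k` and the derivations `L k α = ∂/∂λ^α_k`, in which every element depends on finitely
many of the `λ_k`. -/
structure JetCalculus (K : Type*) [CommRing K] [Algebra ℝ K] (n l : ℕ) where
  X : Fin n → Derivation ℝ K K
  T : Derivation ℝ K K
  L : ℕ → Fin l → Derivation ℝ K K
  lam : ℕ → Fin l → K
  X_comm : ∀ i j a, X i (X j a) = X j (X i a)
  X_T : ∀ i a, X i (T a) = T (X i a)
  X_L : ∀ i k α a, X i (L k α a) = L k α (X i a)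
  L_zero_T : ∀ α a, L 0 α (T a) = T (L 0 α a)
  L_succ_T : ∀ k α a, L (k + 1) α (T a) = T (L (k + 1) α a) + L k α a
  X_lam : ∀ i k α, X i (lam k α) = 0
  L_lam : ∀ j k β α, L j β (lam k α) = if j = k ∧ β = α then 1 else 0
  exists_order : ∀ a, ∃ N, ∀ M, N ≤ M → (∀ α, L M α a = 0) ∧
    T a = ∑ k ∈ Finset.range M, ∑ α, lam (k + 1) α * L k α a

/-! ### Passage to the ring of fractions -/

section Fractions

variable {A : Type*} [CommRing A] [Algebra ℝ A]

theorem derivation_sum_apply {ι : Type*} (s : Finset ι) (d : ι → Derivation ℝ A A) (x : A) :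
    (∑ j ∈ s, d j) x = ∑ j ∈ s, d j x := by
  classical
  induction s using Finset.induction_on with
  | empty => simp
  | insert a s ha ih => rw [Finset.sum_insert ha, Finset.sum_insert ha, Derivation.add_apply, ih]

/-- The quotient rule: a derivation is determined at `f / g` by its values at `f` and `g`. Stated
pointwise, it also compares derivations that agree only on particular elements. -/
theorem derivation_eq_of_mul_eq {d d' : Derivation ℝ (FractionRing A) (FractionRing A)}
    {x f g : FractionRing A} (hg : IsUnit g) (hx : x * g = f) (hf' : d f = d' f)
    (hg' : d g = d' g) : d x = d' x := by
  subst hx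
  rw [Derivation.leibniz, Derivation.leibniz, hg'] at hf'
  have : g * d x = g * d' x := by simpa [smul_eq_mul] using hf'
  exact hg.mul_left_cancel this

theorem derivation_fractionRing_ext {d d' : Derivation ℝ (FractionRing A) (FractionRing A)}
    (h : ∀ a : A, d (algebraMap A _ a) = d' (algebraMap A _ a)) (x : FractionRing A) :
    d x = d' x := by
  obtain ⟨⟨a, b⟩, hx⟩ := IsLocalization.surj (nonZeroDivisors A) x
  exact derivation_eq_of_mul_eq (IsLocalization.map_units _ b) hx (h _) (h _)

theorem fractionDerivation_commutator {d d' e : Derivation ℝ A A}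
    (h : ∀ a, d (d' a) = d' (d a) + e a) (x : FractionRing A) :
    fractionDerivation d (fractionDerivation d' x) =
      fractionDerivation d' (fractionDerivation d x) + fractionDerivation e x := by
  -- The commutator is itself a derivation, so it suffices to compare both sides on the original
  -- ring.
  have : ⁅fractionDerivation d, fractionDerivation d'⁆ x = fractionDerivation e x := by
    apply derivation_fractionRing_ext
    intro a
    simp only [Derivation.commutator_apply, fractionDerivation_algebraMap, h, map_add,
      add_sub_cancel_left]
  rw [← this, Derivation.commutator_apply]
  abel

theorem fractionDerivation_comm {d d' : Derivation ℝ A A} (h : ∀ a, d (d' a) = d' (d a))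
    (x : FractionRing A) :
    fractionDerivation d (fractionDerivation d' x) =
      fractionDerivation d' (fractionDerivation d x) := by
  have h0 : fractionDerivation (0 : Derivation ℝ A A) x =
      (0 : Derivation ℝ (FractionRing A) (FractionRing A)) x :=
    derivation_fractionRing_ext (fun a => by simp [fractionDerivation_algebraMap]) x
  rw [fractionDerivation_commutator (e := 0) (fun a => by simp [h]), h0]
  simp

/-- The calculus on the total ring of fractions. -/
def JetCalculus.fractions {n l : ℕ} (C : JetCalculus A n l) :
    JetCalculus (FractionRing A) n l where
  X i := fractionDerivation (C.X i)
  T := fractionDerivation C.T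
  L k α := fractionDerivation (C.L k α)
  lam k α := algebraMap A _ (C.lam k α)
  X_comm i j := fractionDerivation_comm (C.X_comm i j)
  X_T i := fractionDerivation_comm (C.X_T i)
  X_L i k α := fractionDerivation_comm (C.X_L i k α)
  L_zero_T α := fractionDerivation_comm (C.L_zero_T α)
  L_succ_T k α := fractionDerivation_commutator (C.L_succ_T k α)
  X_lam i k α := by rw [fractionDerivation_algebraMap, C.X_lam, map_zero]
  L_lam j k β α := by
    rw [fractionDerivation_algebraMap, C.L_lam]
    split_ifs <;> simp
  exists_order x := by
    obtain ⟨⟨f, g⟩, hx⟩ := IsLocalization.surj (nonZeroDivisors A) x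
    obtain ⟨N₁, h₁⟩ := C.exists_order f
    obtain ⟨N₂, h₂⟩ := C.exists_order g
    refine ⟨max N₁ N₂, fun M hM => ?_⟩
    replace h₁ := h₁ M (by omega)
    replace h₂ := h₂ M (by omega)
    have hu := IsLocalization.map_units (FractionRing A) g
    refine ⟨fun α => ?_, ?_⟩
    · refine derivation_eq_of_mul_eq (d' := 0) hu hx ?_ ?_
      · simp [fractionDerivation_algebraMap, h₁.1 α]
      · simp [fractionDerivation_algebraMap, h₂.1 α]
    -- The truncated sum is viewed as one derivation, which agrees with `∂` on the numerator and the
    -- denominator, hence on the fraction.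
    · have e : ∀ y, (∑ k ∈ Finset.range M, ∑ α, algebraMap A (FractionRing A) (C.lam (k + 1) α) •
          fractionDerivation (C.L k α) : Derivation ℝ (FractionRing A) (FractionRing A)) y =
          ∑ k ∈ Finset.range M, ∑ α, algebraMap A (FractionRing A) (C.lam (k + 1) α) *
            fractionDerivation (C.L k α) y := by
        intro y
        simp only [derivation_sum_apply, Derivation.coe_smul, Pi.smul_apply, smul_eq_mul]
      rw [← e]
      refine derivation_eq_of_mul_eq hu hx ?_ ?_
      · simp only [e, fractionDerivation_algebraMap, h₁.2, map_sum, map_mul]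
      · simp only [e, fractionDerivation_algebraMap, h₂.2, map_sum, map_mul]

end Fractions

namespace JetCalculus

variable {K : Type*} [CommRing K] [Algebra ℝ K] {n l : ℕ} (C : JetCalculus K n l)

/-! ### Vector fields -/

/-- The derivative of a function along a vector field. -/
def lie (w : Fin n → K) (a : K) : K := ∑ i, w i * C.X i a

/-- The commutator of vector fields. -/
def br (v w : Fin n → K) : Fin n → K := fun i => C.lie v (w i) - C.lie w (v i)

theorem br_apply (v w : Fin n → K) (i : Fin n) :
    C.br v w i = C.lie v (w i) - C.lie w (v i) := rfl

/-- A derivation acting on the components of a vector field. -/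
def comp (d : Derivation ℝ K K) (w : Fin n → K) : Fin n → K := fun i => d (w i)

theorem lie_add_left (v w : Fin n → K) (a : K) : C.lie (v + w) a = C.lie v a + C.lie w a := by
  simp [lie, add_mul, Finset.sum_add_distrib]

theorem lie_neg_left (v : Fin n → K) (a : K) : C.lie (-v) a = -C.lie v a := by
  simp [lie]

theorem lie_zero_left (a : K) : C.lie 0 a = 0 := by
  simp [lie]

theorem lie_smul_left (f : K) (v : Fin n → K) (a : K) : C.lie (f • v) a = f * C.lie v a := by
  simp [lie, Finset.mul_sum, mul_assoc]

theorem lie_sum_left {ι : Type*} (s : Finset ι) (v : ι → Fin n → K) (a : K) :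
    C.lie (∑ j ∈ s, v j) a = ∑ j ∈ s, C.lie (v j) a := by
  simp only [lie, Finset.sum_apply, Finset.sum_mul]
  exact Finset.sum_comm

theorem lie_add (v : Fin n → K) (a b : K) : C.lie v (a + b) = C.lie v a + C.lie v b := by
  simp [lie, mul_add, Finset.sum_add_distrib]

theorem lie_sub (v : Fin n → K) (a b : K) : C.lie v (a - b) = C.lie v a - C.lie v b := by
  simp [lie, mul_sub, Finset.sum_sub_distrib]

theorem lie_mul (v : Fin n → K) (a b : K) : C.lie v (a * b) = a * C.lie v b + b * C.lie v a := by
  simp only [lie, Derivation.leibniz, smul_eq_mul, Finset.mul_sum, ← Finset.sum_add_distrib]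
  exact Finset.sum_congr rfl fun i _ => by ring

theorem lie_lam (v : Fin n → K) (k : ℕ) (α : Fin l) : C.lie v (C.lam k α) = 0 := by
  simp [lie, C.X_lam]

theorem lie_comp {d : Derivation ℝ K K} (hd : ∀ i a, C.X i (d a) = d (C.X i a))
    (w : Fin n → K) (a : K) : d (C.lie w a) = C.lie (comp d w) a + C.lie w (d a) := by
  simp only [lie, comp, map_sum, Derivation.leibniz, smul_eq_mul, hd, ← Finset.sum_add_distrib]
  exact Finset.sum_congr rfl fun i _ => by ring

/-- The second-order terms of the two compositions agree because the `∂/∂xⁱ` commute; the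
first-order terms that remain are the bracket. The Jacobi identity in `isLieDer_br` follows from
this. -/
theorem lie_br (v w : Fin n → K) (a : K) :
    C.lie (C.br v w) a = C.lie v (C.lie w a) - C.lie w (C.lie v a) := by
  have h : ∀ v w : Fin n → K, C.lie v (C.lie w a) =
      ∑ i, ∑ j, v i * C.X i (w j) * C.X j a + ∑ i, ∑ j, v i * w j * C.X i (C.X j a) := by
    intro v w
    simp only [lie, map_sum, Derivation.leibniz, smul_eq_mul, Finset.mul_sum,
      ← Finset.sum_add_distrib]
    exact Finset.sum_congr rfl fun i _ => Finset.sum_congr rfl fun j _ => by ring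
  have h' : ∑ i, ∑ j, v i * w j * C.X i (C.X j a) = ∑ i, ∑ j, w i * v j * C.X i (C.X j a) := by
    rw [Finset.sum_comm]
    exact Finset.sum_congr rfl fun i _ => Finset.sum_congr rfl fun j _ => by
      rw [C.X_comm j i]; ring
  rw [h, h, h', add_sub_add_right_eq_sub]
  simp only [lie, br, sub_mul, Finset.sum_sub_distrib, Finset.sum_mul]
  rw [Finset.sum_comm]
  congr 1
  exact Finset.sum_comm

theorem br_swap (v w : Fin n → K) : C.br v w = -C.br w v := by
  funext i
  simp [br]

theorem br_add_right (u v w : Fin n → K) : C.br u (v + w) = C.br u v + C.br u w := by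
  funext i
  simp only [br, Pi.add_apply, lie_add, lie_add_left]
  ring

theorem br_add_left (u v w : Fin n → K) : C.br (u + v) w = C.br u w + C.br v w := by
  funext i
  simp only [br, Pi.add_apply, lie_add, lie_add_left]
  ring

theorem br_smul_right (f : K) (v w : Fin n → K) :
    C.br v (f • w) = f • C.br v w + C.lie v f • w := by
  funext i
  simp only [br, Pi.add_apply, Pi.smul_apply, smul_eq_mul, lie_mul, lie_smul_left]
  ring

theorem br_smul_left (f : K) (v w : Fin n → K) :
    C.br (f • v) w = f • C.br v w - C.lie w f • v := by
  rw [br_swap, br_smul_right, C.br_swap w v, smul_neg]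
  abel

theorem br_zero_left (w : Fin n → K) : C.br 0 w = 0 := by
  simpa using C.br_add_left 0 0 w

theorem br_sum_left {ι : Type*} (s : Finset ι) (v : ι → Fin n → K) (w : Fin n → K) :
    C.br (∑ j ∈ s, v j) w = ∑ j ∈ s, C.br (v j) w := by
  classical
  induction s using Finset.induction_on with
  | empty => simp [br_zero_left]
  | insert a s ha ih => rw [Finset.sum_insert ha, Finset.sum_insert ha, br_add_left, ih]

/-- An additive operator on vector fields that is compatible with the multiplication by functions
and is a derivation of the commutator. -/
structure IsLieDer (δ : (Fin n → K) → Fin n → K) (θ : K → K) : Prop where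
  map_add : ∀ v w, δ (v + w) = δ v + δ w
  map_smul : ∀ f w, δ (f • w) = f • δ w + θ f • w
  map_br : ∀ v w, δ (C.br v w) = C.br (δ v) w + C.br v (δ w)

theorem isLieDer_br (v : Fin n → K) : C.IsLieDer (C.br v) (C.lie v) where
  map_add := C.br_add_right v
  map_smul f w := C.br_smul_right f v w
  map_br u w := by
    funext i
    simp only [Pi.add_apply, br_apply, lie_sub, lie_br]
    ring

theorem isLieDer_comp {d : Derivation ℝ K K} (hd : ∀ i a, C.X i (d a) = d (C.X i a)) :
    C.IsLieDer (comp d) d where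
  map_add v w := by funext i; simp [comp]
  map_smul f w := by
    funext i
    simp only [comp, Pi.add_apply, Pi.smul_apply, smul_eq_mul, Derivation.leibniz]
    ring
  map_br v w := by
    funext i
    simp only [Pi.add_apply]
    have e : comp d (C.br v w) i = d (C.lie v (w i)) - d (C.lie w (v i)) := by
      simp [comp, br]
    rw [e, C.lie_comp hd, C.lie_comp hd]
    simp only [br, comp]
    ring

namespace IsLieDer

variable {C} {δ δ' : (Fin n → K) → Fin n → K} {θ θ' : K → K}

theorem add (h : C.IsLieDer δ θ) (h' : C.IsLieDer δ' θ') :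
    C.IsLieDer (fun w => δ w + δ' w) (fun a => θ a + θ' a) where
  map_add v w := by rw [h.map_add, h'.map_add]; abel
  map_smul f w := by rw [h.map_smul, h'.map_smul, add_smul, smul_add]; abel
  map_br v w := by rw [h.map_br, h'.map_br, br_add_left, br_add_right]; abel

theorem map_zero (h : C.IsLieDer δ θ) : δ 0 = 0 := by
  simpa using h.map_add 0 0

/-- The vector fields in `P` that are mapped to `P`. -/
def preimage (h : C.IsLieDer δ θ) (P : Submodule K (Fin n → K)) : Submodule K (Fin n → K) where
  carrier := {w | w ∈ P ∧ δ w ∈ P}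
  add_mem' := by
    rintro v w ⟨hv, hv'⟩ ⟨hw, hw'⟩
    exact ⟨P.add_mem hv hw, by rw [h.map_add]; exact P.add_mem hv' hw'⟩
  zero_mem' := ⟨P.zero_mem, by rw [h.map_zero]; exact P.zero_mem⟩
  smul_mem' := by
    rintro f w ⟨hw, hw'⟩
    exact ⟨P.smul_mem _ hw, by
      rw [h.map_smul]; exact P.add_mem (P.smul_mem _ hw') (P.smul_mem _ hw)⟩

/-- The extra term `θ f • w` of the Leibniz rule lies in `P` along with `w`, so stability can be
checked on generators although `δ` is not linear over functions. -/
theorem mem_of_mem_span (h : C.IsLieDer δ θ) {S : Set (Fin n → K)} {P : Submodule K (Fin n → K)}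
    (hS : ∀ w ∈ S, w ∈ P ∧ δ w ∈ P) {w : Fin n → K} (hw : w ∈ Submodule.span K S) : δ w ∈ P :=
  ((Submodule.span_le (p := h.preimage P)).2 hS hw).2

end IsLieDer

/-! ### Involutive distributions -/

/-- Closedness with respect to the commutator. -/
def Involutive (P : Submodule K (Fin n → K)) : Prop := ∀ v ∈ P, ∀ w ∈ P, C.br v w ∈ P

/-- The smallest involutive distribution that contains `S`. -/
def closure (S : Set (Fin n → K)) : Submodule K (Fin n → K) :=
  sInf {P | S ⊆ P ∧ C.Involutive P}

theorem subset_closure (S : Set (Fin n → K)) : S ⊆ C.closure S := by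
  intro w hw
  refine (Submodule.mem_sInf).2 fun P hP => hP.1 hw

theorem closure_le {S : Set (Fin n → K)} {P : Submodule K (Fin n → K)} (hS : S ⊆ P)
    (hP : C.Involutive P) : C.closure S ≤ P := sInf_le ⟨hS, hP⟩

theorem closure_involutive (S : Set (Fin n → K)) : C.Involutive (C.closure S) := by
  intro v hv w hw
  refine (Submodule.mem_sInf).2 fun P hP => ?_
  exact hP.2 v ((Submodule.mem_sInf).1 hv P hP) w ((Submodule.mem_sInf).1 hw P hP)

theorem closure_mono {S S' : Set (Fin n → K)} (h : S ⊆ S') : C.closure S ≤ C.closure S' :=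
  C.closure_le (h.trans (C.subset_closure S')) (C.closure_involutive S')

/-- Because `δ` is a derivation of the commutator, the vector fields of `P` that `δ` maps into `P`
form an involutive distribution. -/
theorem IsLieDer.mem_of_mem_closure {C : JetCalculus K n l} {δ : (Fin n → K) → Fin n → K}
    {θ : K → K} (h : C.IsLieDer δ θ) {S : Set (Fin n → K)} {P : Submodule K (Fin n → K)}
    (hP : C.Involutive P) (hS : ∀ w ∈ S, w ∈ P ∧ δ w ∈ P) {w : Fin n → K} (hw : w ∈ C.closure S) :
    δ w ∈ P := by
  refine (C.closure_le (P := h.preimage P) hS ?_ hw).2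
  rintro v ⟨hv, hv'⟩ w ⟨hw, hw'⟩
  refine ⟨hP v hv w hw, ?_⟩
  rw [h.map_br]
  exact P.add_mem (hP _ hv' _ hw) (hP _ hv _ hw')

end JetCalculus

namespace JetCalculus

variable {K : Type*} [CommRing K] [Algebra ℝ K] {n l : ℕ} (C : JetCalculus K n l)
  (V : Fin n → K) (Z : Fin l → Fin n → K)

/-! ### The distributions of an affine control system -/

/-- Vector fields that depend neither on time derivatives nor on the `λ_k`. -/
structure IsConst (w : Fin n → K) : Prop where
  T_eq : ∀ i, C.T (w i) = 0
  L_eq : ∀ k α i, C.L k α (w i) = 0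

/-- The right hand side `V + λ^α Z_α`. -/
def vel : Fin n → K := V + ∑ α, C.lam 0 α • Z α

/-- The operator `D w = -∂w - [V, w] - λ^α [Z_α, w]`. -/
def D (w : Fin n → K) : Fin n → K :=
  -(fun i => C.T (w i)) - C.br V w - ∑ α, C.lam 0 α • C.br (Z α) w

/-- The opposite `∂w + [V + λ^α Z_α, w]` of the operator `D`. -/
def evol (w : Fin n → K) : Fin n → K := comp C.T w + C.br (C.vel V Z) w

/-- The span of the `Z_α`. -/
def charDist (Z : Fin l → Fin n → K) : Submodule K (Fin n → K) :=
  Submodule.span K (Set.range fun α => Z α)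

/-- The span of the `D^m u`. -/
def lamDist : Submodule K (Fin n → K) :=
  Submodule.span K {w | ∃ u ∈ charDist Z, ∃ m : ℕ, w = (C.D V Z)^[m] u}

/-- The Lie closure of the `(ad_V)^m u`, `m ≤ k`. -/
def filtration (k : ℕ) : Submodule K (Fin n → K) :=
  C.closure (⋃ m ∈ Set.Iic k, (C.br V)^[m] '' (charDist Z : Set (Fin n → K)))

/-- The union of the filtration. -/
def gaugeDist : Submodule K (Fin n → K) := ⨆ k, C.filtration V Z k

variable {V Z}

theorem br_vel (w : Fin n → K) :
    C.br (C.vel V Z) w = C.br V w + ∑ α, C.lam 0 α • C.br (Z α) w := by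
  rw [vel, br_add_left, br_sum_left]
  congr 1
  refine Finset.sum_congr rfl fun α _ => ?_
  rw [br_smul_left, lie_lam, zero_smul, sub_zero]

theorem D_eq (w : Fin n → K) : C.D V Z w = -C.evol V Z w := by
  rw [evol, br_vel, D]
  have : (fun i => C.T (w i)) = comp C.T w := rfl
  rw [this]
  abel

theorem isLieDer_evol :
    C.IsLieDer (C.evol V Z) fun a => C.T a + C.lie (C.vel V Z) a :=
  (C.isLieDer_comp C.X_T).add (C.isLieDer_br _)

theorem Z_mem_charDist {K : Type*} [CommRing K] {n l : ℕ} {Z : Fin l → Fin n → K} (α : Fin l) : Z α ∈ charDist Z :=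
  Submodule.subset_span ⟨α, rfl⟩

theorem sum_mem_charDist {K : Type*} [CommRing K] {n l : ℕ} {Z : Fin l → Fin n → K}
    (s : Fin l → K) : ∑ α, s α • Z α ∈ charDist Z :=
  Submodule.sum_mem _ fun α _ => Submodule.smul_mem _ _ (Z_mem_charDist α)

theorem charDist_le_lamDist : charDist Z ≤ C.lamDist V Z :=
  fun w hw => Submodule.subset_span ⟨w, hw, 0, rfl⟩

theorem evol_mem_lamDist {w : Fin n → K} (hw : w ∈ C.lamDist V Z) :
    C.evol V Z w ∈ C.lamDist V Z := by
  refine C.isLieDer_evol.mem_of_mem_span ?_ hw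
  rintro w ⟨u, hu, m, rfl⟩
  refine ⟨Submodule.subset_span ⟨u, hu, m, rfl⟩, ?_⟩
  rw [← neg_neg (C.evol V Z _), ← D_eq, ← Function.iterate_succ_apply' (C.D V Z)]
  exact Submodule.neg_mem _ (Submodule.subset_span ⟨u, hu, m + 1, rfl⟩)

theorem lamDist_le {P : Submodule K (Fin n → K)} (hZ : charDist Z ≤ P)
    (hP : ∀ w ∈ P, C.evol V Z w ∈ P) : C.lamDist V Z ≤ P := by
  refine Submodule.span_le.2 ?_
  rintro w ⟨u, hu, m, rfl⟩
  induction m with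
  | zero => exact hZ hu
  | succ m ih =>
    rw [Function.iterate_succ_apply', D_eq]
    exact P.neg_mem (hP _ ih)

/-- Membership in `𝒵_D` is carried along with `p`: in the proof of involutivity, the Leibniz rule
for `[f v, w]` leaves a multiple of `v` itself. -/
theorem lamDist_induction {p : (Fin n → K) → Prop} (hZ : ∀ α, p (Z α))
    (hadd : ∀ v ∈ C.lamDist V Z, ∀ w ∈ C.lamDist V Z, p v → p w → p (v + w)) (h0 : p 0)
    (hsmul : ∀ (f : K), ∀ w ∈ C.lamDist V Z, p w → p (f • w))
    (hE : ∀ w ∈ C.lamDist V Z, p w → p (C.evol V Z w)) {w : Fin n → K}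
    (hw : w ∈ C.lamDist V Z) : p w := by
  let P : Submodule K (Fin n → K) :=
    { carrier := {w | w ∈ C.lamDist V Z ∧ p w}
      add_mem' := fun ha hb => ⟨Submodule.add_mem _ ha.1 hb.1, hadd _ ha.1 _ hb.1 ha.2 hb.2⟩
      zero_mem' := ⟨Submodule.zero_mem _, h0⟩
      smul_mem' := fun f _ ha => ⟨Submodule.smul_mem _ f ha.1, hsmul f _ ha.1 ha.2⟩ }
  refine (C.lamDist_le (P := P) (Submodule.span_le.2 ?_) ?_ hw).2
  · rintro _ ⟨α, rfl⟩
    exact ⟨C.charDist_le_lamDist (Z_mem_charDist α), hZ α⟩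
  · exact fun w hw => ⟨C.evol_mem_lamDist hw.1, hE w hw.1 hw.2⟩

theorem filtration_mono : Monotone (C.filtration V Z) := fun _ _ h =>
  C.closure_mono (Set.biUnion_subset_biUnion_left fun _ hm => le_trans hm h)

theorem filtration_le_gaugeDist (k : ℕ) : C.filtration V Z k ≤ C.gaugeDist V Z :=
  le_iSup (C.filtration V Z) k

theorem mem_gaugeDist {w : Fin n → K} : w ∈ C.gaugeDist V Z ↔ ∃ k, w ∈ C.filtration V Z k :=
  Submodule.mem_iSup_of_directed _ C.filtration_mono.directed_le

theorem iterate_mem_filtration {k m : ℕ} (hm : m ≤ k) {u : Fin n → K} (hu : u ∈ charDist Z) :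
    (C.br V)^[m] u ∈ C.filtration V Z k := by
  refine C.subset_closure _ ?_
  simp only [Set.mem_iUnion]
  exact ⟨m, hm, u, hu, rfl⟩

theorem charDist_le_gaugeDist : charDist Z ≤ C.gaugeDist V Z := fun _ hu =>
  C.filtration_le_gaugeDist 0 (C.iterate_mem_filtration (m := 0) le_rfl hu)

theorem gaugeDist_involutive : C.Involutive (C.gaugeDist V Z) := by
  intro v hv w hw
  obtain ⟨k, hk⟩ := C.mem_gaugeDist.1 hv
  obtain ⟨j, hj⟩ := C.mem_gaugeDist.1 hw
  exact C.filtration_le_gaugeDist (max k j) (C.closure_involutive _ _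
    (C.filtration_mono (le_max_left k j) hk) _ (C.filtration_mono (le_max_right k j) hj))

/-- On generators `ad_V` raises the number of brackets by one, hence moves at most one step up the
filtration; the derivation property extends this to the Lie closure. -/
theorem br_drift_mem_gaugeDist {w : Fin n → K} (hw : w ∈ C.gaugeDist V Z) :
    C.br V w ∈ C.gaugeDist V Z := by
  obtain ⟨k, hk⟩ := C.mem_gaugeDist.1 hw
  refine (C.isLieDer_br V).mem_of_mem_closure C.gaugeDist_involutive ?_ hk
  intro w hw
  simp only [Set.mem_iUnion] at hw
  obtain ⟨m, -, u, hu, rfl⟩ := hw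
  refine ⟨C.filtration_le_gaugeDist m (C.iterate_mem_filtration le_rfl hu), ?_⟩
  rw [← Function.iterate_succ_apply' (C.br V)]
  exact C.filtration_le_gaugeDist (m + 1) (C.iterate_mem_filtration le_rfl hu)

theorem comp_T_mem_charDist (hZ : ∀ α, C.IsConst (Z α)) {w : Fin n → K} (hw : w ∈ charDist Z) :
    comp C.T w ∈ charDist Z := by
  refine (C.isLieDer_comp C.X_T).mem_of_mem_span ?_ hw
  rintro _ ⟨α, rfl⟩
  have : comp C.T (Z α) = 0 := funext fun i => (hZ α).T_eq i
  exact ⟨Z_mem_charDist α, by rw [this]; exact Submodule.zero_mem _⟩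

theorem comp_T_iterate_br (hV : C.IsConst V) (m : ℕ) (u : Fin n → K) :
    comp C.T ((C.br V)^[m] u) = (C.br V)^[m] (comp C.T u) := by
  induction m with
  | zero => rfl
  | succ m ih =>
    have : comp C.T V = 0 := funext fun i => hV.T_eq i
    rw [Function.iterate_succ_apply', Function.iterate_succ_apply',
      (C.isLieDer_comp C.X_T).map_br, this, br_zero_left, zero_add, ih]

theorem comp_T_mem_gaugeDist (hV : C.IsConst V) (hZ : ∀ α, C.IsConst (Z α)) {w : Fin n → K}
    (hw : w ∈ C.gaugeDist V Z) : comp C.T w ∈ C.gaugeDist V Z := by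
  obtain ⟨k, hk⟩ := C.mem_gaugeDist.1 hw
  refine (C.isLieDer_comp C.X_T).mem_of_mem_closure C.gaugeDist_involutive ?_ hk
  intro w hw
  simp only [Set.mem_iUnion] at hw
  obtain ⟨m, -, u, hu, rfl⟩ := hw
  rw [C.comp_T_iterate_br hV]
  exact ⟨C.filtration_le_gaugeDist m (C.iterate_mem_filtration le_rfl hu),
    C.filtration_le_gaugeDist m
      (C.iterate_mem_filtration le_rfl (C.comp_T_mem_charDist hZ hu))⟩

theorem lamDist_le_gaugeDist (hV : C.IsConst V) (hZ : ∀ α, C.IsConst (Z α)) :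
    C.lamDist V Z ≤ C.gaugeDist V Z := by
  refine C.lamDist_le C.charDist_le_gaugeDist fun w hw => ?_
  rw [evol, br_vel]
  refine Submodule.add_mem _ (C.comp_T_mem_gaugeDist hV hZ hw)
    (Submodule.add_mem _ (C.br_drift_mem_gaugeDist hw) (Submodule.sum_mem _ fun α _ => ?_))
  exact Submodule.smul_mem _ _
    (C.gaugeDist_involutive _ (C.charDist_le_gaugeDist (Z_mem_charDist α)) _ hw)

/-! ### Independence of the `λ_k` -/

theorem isLieDer_comp_L (k : ℕ) (α : Fin l) : C.IsLieDer (comp (C.L k α)) (C.L k α) :=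
  C.isLieDer_comp fun i a => C.X_L i k α a

theorem comp_L_vel (hV : C.IsConst V) (hZ : ∀ α, C.IsConst (Z α)) (k : ℕ) (β : Fin l) :
    comp (C.L k β) (C.vel V Z) = if k = 0 then Z β else 0 := by
  funext i
  have h : comp (C.L k β) (C.vel V Z) i = ∑ α, (if k = 0 ∧ β = α then 1 else 0) * Z α i := by
    simp only [comp, vel, Pi.add_apply, Finset.sum_apply, Pi.smul_apply, smul_eq_mul, map_add,
      map_sum, Derivation.leibniz, hV.L_eq, (hZ _).L_eq, C.L_lam, mul_zero, zero_add]
    exact Finset.sum_congr rfl fun α _ => by ring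
  rw [h]
  by_cases hk : k = 0
  · simp [hk]
  · simp [hk]

theorem comp_L_succ_evol (hV : C.IsConst V) (hZ : ∀ α, C.IsConst (Z α)) (k : ℕ) (β : Fin l)
    (w : Fin n → K) : comp (C.L (k + 1) β) (C.evol V Z w) =
      C.evol V Z (comp (C.L (k + 1) β) w) + comp (C.L k β) w := by
  rw [evol, (C.isLieDer_comp_L _ _).map_add, (C.isLieDer_comp_L _ _).map_br, C.comp_L_vel hV hZ,
    if_neg (Nat.succ_ne_zero k), br_zero_left, zero_add, evol]
  have : comp (C.L (k + 1) β) (comp C.T w) =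
      comp C.T (comp (C.L (k + 1) β) w) + comp (C.L k β) w := by
    funext i
    simp [comp, C.L_succ_T]
  rw [this]
  abel

/-- The only dependence of `E` on `λ_0` is through the velocity `V + λ^α Z_α`, whose derivative
along `λ^β_0` is `Z_β`. This is how the separate brackets with the `Z_β` are recovered from `E`. -/
theorem comp_L_zero_evol (hV : C.IsConst V) (hZ : ∀ α, C.IsConst (Z α)) (β : Fin l)
    (w : Fin n → K) : comp (C.L 0 β) (C.evol V Z w) =
      C.evol V Z (comp (C.L 0 β) w) + C.br (Z β) w := by
  rw [evol, (C.isLieDer_comp_L _ _).map_add, (C.isLieDer_comp_L _ _).map_br, C.comp_L_vel hV hZ,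
    if_pos rfl, evol]
  have : comp (C.L 0 β) (comp C.T w) = comp C.T (comp (C.L 0 β) w) := by
    funext i
    simp [comp, C.L_zero_T]
  rw [this]
  abel

theorem exists_order_comp (w : Fin n → K) : ∃ N, ∀ M, N ≤ M →
    (∀ α, comp (C.L M α) w = 0) ∧
      comp C.T w = ∑ k ∈ Finset.range M, ∑ α, C.lam (k + 1) α • comp (C.L k α) w := by
  choose N hN using fun i => C.exists_order (w i)
  refine ⟨Finset.univ.sup N, fun M hM => ?_⟩
  have h := fun i => hN i M ((Finset.le_sup (Finset.mem_univ i)).trans hM)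
  refine ⟨fun α => funext fun i => (h i).1 α, funext fun i => ?_⟩
  simp only [Finset.sum_apply, Pi.smul_apply, smul_eq_mul]
  exact (h i).2

/-! ### Stability of `𝒵_D` and the equality with `𝒵_V` -/

variable [IsNoetherianRing K]

theorem comp_L_mem_lamDist (hV : C.IsConst V) (hZ : ∀ α, C.IsConst (Z α)) (k : ℕ) (α : Fin l)
    {w : Fin n → K} (hw : w ∈ C.lamDist V Z) : comp (C.L k α) w ∈ C.lamDist V Z := by
  -- A finite generating set has a common order bound `s.sup N`, beyond which `∂/∂λ_k` kills every
  -- generator.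
  obtain ⟨s, hs⟩ := IsNoetherian.noetherian (C.lamDist V Z)
  choose N hN using C.exists_order_comp
  have hlarge : ∀ k, s.sup N ≤ k → ∀ α, ∀ w ∈ C.lamDist V Z,
      comp (C.L k α) w ∈ C.lamDist V Z := by
    intro k hk α w hw
    rw [← hs] at hw
    refine (C.isLieDer_comp_L k α).mem_of_mem_span (fun u hu => ?_) hw
    refine ⟨hs ▸ Submodule.subset_span hu, ?_⟩
    rw [(hN u k ((Finset.le_sup hu).trans hk)).1]
    exact Submodule.zero_mem _
  -- Since `∂/∂λ_k` is the commutator of `∂/∂λ_{k+1}` with `E`, stability descends from `k + 1` to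
  -- `k`.
  have hdesc : ∀ k, (∀ α, ∀ w ∈ C.lamDist V Z, comp (C.L (k + 1) α) w ∈ C.lamDist V Z) →
      ∀ α, ∀ w ∈ C.lamDist V Z, comp (C.L k α) w ∈ C.lamDist V Z := by
    intro k hk α w hw
    rw [← sub_eq_iff_eq_add'.2 (C.comp_L_succ_evol hV hZ k α w)]
    exact Submodule.sub_mem _ (hk α _ (C.evol_mem_lamDist hw)) (C.evol_mem_lamDist (hk α _ hw))
  have hall : ∀ j k, s.sup N ≤ k + j → ∀ α, ∀ w ∈ C.lamDist V Z,
      comp (C.L k α) w ∈ C.lamDist V Z := by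
    intro j
    induction j with
    | zero => exact hlarge
    | succ j ih => exact fun k hk => hdesc k (ih (k + 1) (by omega))
  exact hall (s.sup N) k (by omega) α w hw

theorem br_Z_mem_lamDist (hV : C.IsConst V) (hZ : ∀ α, C.IsConst (Z α)) (α : Fin l)
    {w : Fin n → K} (hw : w ∈ C.lamDist V Z) : C.br (Z α) w ∈ C.lamDist V Z := by
  rw [← sub_eq_iff_eq_add'.2 (C.comp_L_zero_evol hV hZ α w)]
  exact Submodule.sub_mem _ (C.comp_L_mem_lamDist hV hZ 0 α (C.evol_mem_lamDist hw))
    (C.evol_mem_lamDist (C.comp_L_mem_lamDist hV hZ 0 α hw))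

theorem comp_T_mem_lamDist (hV : C.IsConst V) (hZ : ∀ α, C.IsConst (Z α))
    {w : Fin n → K} (hw : w ∈ C.lamDist V Z) : comp C.T w ∈ C.lamDist V Z := by
  obtain ⟨N, hN⟩ := C.exists_order_comp w
  rw [(hN N le_rfl).2]
  exact Submodule.sum_mem _ fun k _ => Submodule.sum_mem _ fun α _ =>
    Submodule.smul_mem _ _ (C.comp_L_mem_lamDist hV hZ k α hw)

theorem br_drift_mem_lamDist (hV : C.IsConst V) (hZ : ∀ α, C.IsConst (Z α))
    {w : Fin n → K} (hw : w ∈ C.lamDist V Z) : C.br V w ∈ C.lamDist V Z := by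
  have e : C.br V w = C.evol V Z w - comp C.T w - ∑ α, C.lam 0 α • C.br (Z α) w := by
    rw [evol, br_vel]
    abel
  rw [e]
  exact Submodule.sub_mem _ (Submodule.sub_mem _ (C.evol_mem_lamDist hw)
    (C.comp_T_mem_lamDist hV hZ hw)) (Submodule.sum_mem _ fun α _ =>
      Submodule.smul_mem _ _ (C.br_Z_mem_lamDist hV hZ α hw))

theorem lamDist_involutive (hV : C.IsConst V) (hZ : ∀ α, C.IsConst (Z α)) :
    C.Involutive (C.lamDist V Z) := by
  intro v hv
  refine C.lamDist_induction (p := fun v => ∀ w ∈ C.lamDist V Z, C.br v w ∈ C.lamDist V Z)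
    (fun α w hw => C.br_Z_mem_lamDist hV hZ α hw) ?_ ?_ ?_ ?_ hv
  · intro u _ v _ hu hv w hw
    rw [br_add_left]
    exact Submodule.add_mem _ (hu w hw) (hv w hw)
  · intro w _
    rw [br_zero_left]
    exact Submodule.zero_mem _
  · intro f v hv hv' w hw
    rw [br_smul_left]
    exact Submodule.sub_mem _ (Submodule.smul_mem _ _ (hv' w hw)) (Submodule.smul_mem _ _ hv)
  -- `[E v, w] = E[v, w] - [v, E w]`; the last term is covered because `hv'` holds for every `w` in
  -- `𝒵_D`.
  · intro v _ hv' w hw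
    rw [← sub_eq_iff_eq_add.2 (C.isLieDer_evol.map_br v w)]
    exact Submodule.sub_mem _ (C.evol_mem_lamDist (hv' w hw)) (hv' _ (C.evol_mem_lamDist hw))

theorem lamDist_eq_gaugeDist (hV : C.IsConst V) (hZ : ∀ α, C.IsConst (Z α)) :
    C.lamDist V Z = C.gaugeDist V Z := by
  refine le_antisymm (C.lamDist_le_gaugeDist hV hZ) (iSup_le fun k => ?_)
  refine C.closure_le ?_ (C.lamDist_involutive hV hZ)
  intro w hw
  simp only [Set.mem_iUnion] at hw
  obtain ⟨m, -, u, hu, rfl⟩ := hw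
  induction m with
  | zero => exact C.charDist_le_lamDist hu
  | succ m ih =>
    rw [Function.iterate_succ_apply']
    exact C.br_drift_mem_lamDist hV hZ ih

end JetCalculus

namespace JetCalculus

variable {K : Type*} [CommRing K] [Algebra ℝ K] {n l : ℕ} (C : JetCalculus K n l)
  (V : Fin n → K) (Z : Fin l → Fin n → K)

/-! ### Chains of vector fields -/

/-- `r_0 ∈ 𝒵` and `r_{j+1} - D r_j ∈ 𝒵` for `j < k`. -/
structure IsChain (k : ℕ) (r : ℕ → Fin n → K) : Prop where
  zero_mem : r 0 ∈ charDist Z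
  succ_mem : ∀ j, j < k → r (j + 1) + C.evol V Z (r j) ∈ charDist Z

variable {V Z} {C}

theorem IsChain.add {k : ℕ} {r r' : ℕ → Fin n → K} (h : C.IsChain V Z k r)
    (h' : C.IsChain V Z k r') : C.IsChain V Z k (r + r') where
  zero_mem := Submodule.add_mem _ h.zero_mem h'.zero_mem
  succ_mem j hj := by
    have e : (r + r') (j + 1) + C.evol V Z ((r + r') j) =
        (r (j + 1) + C.evol V Z (r j)) + (r' (j + 1) + C.evol V Z (r' j)) := by
      rw [Pi.add_apply, Pi.add_apply, C.isLieDer_evol.map_add]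
      abel
    rw [e]
    exact Submodule.add_mem _ (h.succ_mem j hj) (h'.succ_mem j hj)

theorem isChain_zero (k : ℕ) : C.IsChain V Z k 0 where
  zero_mem := Submodule.zero_mem _
  succ_mem j _ := by
    simp only [Pi.zero_apply, C.isLieDer_evol.map_zero, add_zero]
    exact Submodule.zero_mem _

/-- A chain may be delayed. -/
theorem IsChain.delay {k : ℕ} {r : ℕ → Fin n → K} (h : C.IsChain V Z k r) (d : ℕ) :
    C.IsChain V Z (d + k) (fun j => if j < d then 0 else r (j - d)) where
  zero_mem := by
    rcases Nat.eq_zero_or_pos d with rfl | hd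
    · simpa using h.zero_mem
    · simp [hd]
  succ_mem j hj := by
    rcases lt_trichotomy (j + 1) d with hd | hd | hd
    · simp [hd, show j < d by omega, C.isLieDer_evol.map_zero]
    · simpa [← hd, C.isLieDer_evol.map_zero] using h.zero_mem
    · have := h.succ_mem (j - d) (by omega)
      rw [show j - d + 1 = j + 1 - d by omega] at this
      simpa [show ¬ j + 1 < d by omega, show ¬ j < d by omega] using this

/-- A chain may be prolonged. -/
theorem IsChain.prolong {k : ℕ} {r : ℕ → Fin n → K} (h : C.IsChain V Z k r) :
    C.IsChain V Z (k + 1) (Function.update r (k + 1) (-C.evol V Z (r k))) where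
  zero_mem := by simpa using h.zero_mem
  succ_mem j hj := by
    rcases Nat.lt_succ_iff_lt_or_eq.1 hj with hj | rfl
    · rw [Function.update_of_ne (by omega), Function.update_of_ne (by omega)]
      exact h.succ_mem j hj
    · rw [Function.update_self, Function.update_of_ne (by omega), neg_add_cancel]
      exact Submodule.zero_mem _

variable (C V Z)

/-- `w` is the `k`-th member of a chain. -/
def Reaches (k : ℕ) (w : Fin n → K) : Prop := ∃ r, C.IsChain V Z k r ∧ r k = w

variable {V Z} {C}

theorem Reaches.add {k : ℕ} {v w : Fin n → K} (hv : C.Reaches V Z k v) (hw : C.Reaches V Z k w) :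
    C.Reaches V Z k (v + w) := by
  obtain ⟨r, hr, rfl⟩ := hv
  obtain ⟨r', hr', rfl⟩ := hw
  exact ⟨r + r', hr.add hr', rfl⟩

theorem reaches_of_mem {w : Fin n → K} (hw : w ∈ charDist Z) : C.Reaches V Z 0 w :=
  ⟨fun _ => w, ⟨hw, fun _ h => absurd h (Nat.not_lt_zero _)⟩, rfl⟩

theorem Reaches.delay {k d : ℕ} {w : Fin n → K} (hw : C.Reaches V Z k w) :
    C.Reaches V Z (d + k) w := by
  obtain ⟨r, hr, rfl⟩ := hw
  exact ⟨_, hr.delay d, by simp⟩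

theorem Reaches.neg_evol {k : ℕ} {w : Fin n → K} (hw : C.Reaches V Z k w) :
    C.Reaches V Z (k + 1) (-C.evol V Z w) := by
  obtain ⟨r, hr, rfl⟩ := hw
  exact ⟨_, hr.prolong, by simp⟩

/-- Backwards, the chain through `v` is prolonged by `-E v`, and the discrepancy, an element of `𝒵`,
is added as a chain starting only at place `k + 1`. -/
theorem reaches_succ_iff {k : ℕ} {w : Fin n → K} : C.Reaches V Z (k + 1) w ↔
    ∃ v, C.Reaches V Z k v ∧ w + C.evol V Z v ∈ charDist Z := by
  constructor
  · rintro ⟨r, hr, rfl⟩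
    exact ⟨r k, ⟨r, ⟨hr.zero_mem, fun j hj => hr.succ_mem j (by omega)⟩, rfl⟩,
      hr.succ_mem k (Nat.lt_succ_self k)⟩
  · rintro ⟨v, hv, hw⟩
    have := hv.neg_evol.add ((reaches_of_mem hw).delay (d := k + 1))
    rwa [add_comm w, neg_add_cancel_left] at this

/-- Multiplying a whole chain by `f` does not give a chain, since `E(f v) = f E v + θ(f) v`. The
error `θ(f) v` is however reachable at place `k` by induction, hence by delay at place `k + 1`, and
can be compensated. The induction must therefore cover all multipliers at once. -/
theorem Reaches.smul {k : ℕ} {w : Fin n → K} (hw : C.Reaches V Z k w) (f : K) :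
    C.Reaches V Z k (f • w) := by
  induction k generalizing w f with
  | zero =>
    obtain ⟨r, hr, rfl⟩ := hw
    exact reaches_of_mem (Submodule.smul_mem _ f hr.zero_mem)
  | succ k ih =>
    obtain ⟨v, hv, hw⟩ := reaches_succ_iff.1 hw
    have h₁ := (ih hv f).neg_evol
    have h₂ := (ih hv (C.T f + C.lie (C.vel V Z) f)).delay (d := 1)
    have h₃ := (reaches_of_mem (C := C) (V := V) (Submodule.smul_mem _ f hw)).delay (d := k + 1)
    rw [add_comm 1 k] at h₂
    have h := (h₁.add h₂).add h₃
    rw [C.isLieDer_evol.map_smul, smul_add] at h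
    have e : -(f • C.evol V Z v + (C.T f + C.lie (C.vel V Z) f) • v) +
        (C.T f + C.lie (C.vel V Z) f) • v + (f • w + f • C.evol V Z v) = f • w := by abel
    rwa [e] at h

variable (C V Z)

/-- The `k`-th members of chains. -/
def reach (k : ℕ) : Submodule K (Fin n → K) where
  carrier := {w | C.Reaches V Z k w}
  add_mem' := Reaches.add
  zero_mem' := ⟨0, isChain_zero k, rfl⟩
  smul_mem' f _ hw := hw.smul f

theorem reach_mono : Monotone (C.reach V Z) := by
  intro j k hjk w hw
  have := Reaches.delay (d := k - j) hw
  rwa [Nat.sub_add_cancel hjk] at this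

/-- `E` maps the `N`-th reachable subspace into the next one. Once the increasing sequence is
stationary, this subspace is stable under `E`; as it contains `𝒵`, it contains `𝒵_D`. -/
theorem exists_lamDist_le_reach [IsNoetherianRing K] : ∃ N, C.lamDist V Z ≤ C.reach V Z N := by
  obtain ⟨N, hN⟩ := (monotone_stabilizes_iff_noetherian (R := K) (M := Fin n → K)).2 inferInstance
    ⟨C.reach V Z, C.reach_mono V Z⟩
  refine ⟨N, C.lamDist_le (fun w hw => ?_) fun w hw => ?_⟩
  · exact (reaches_of_mem hw).delay (d := N)
  · have h : C.reach V Z N = C.reach V Z (N + 1) := hN (N + 1) (Nat.le_succ N)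
    rw [h, ← neg_neg (C.evol V Z w)]
    exact Submodule.neg_mem _ (Reaches.neg_evol hw)

/-- Every element of `𝒵_D` is a member of a chain that ends with zero. -/
theorem exists_chain [IsNoetherianRing K] {w : Fin n → K} (hw : w ∈ C.lamDist V Z) :
    ∃ (p : ℕ) (r : ℕ → Fin n → K), C.IsChain V Z (p + 1) r ∧ r (p + 1) = 0 ∧
      ∃ k ≤ p, r k = w := by
  obtain ⟨N, hN⟩ := C.exists_lamDist_le_reach V Z
  obtain ⟨r, hr, hrw⟩ := hN hw
  -- The chain is continued beyond place `N` by applying `-E`, which leaves its earlier members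
  -- intact and stays in `𝒵_D`.
  have hprolong : ∀ m, ∃ r', C.IsChain V Z (N + m) r' ∧ r' N = w ∧
      r' (N + m) ∈ C.lamDist V Z := by
    intro m
    induction m with
    | zero => exact ⟨r, hr, hrw, by rw [Nat.add_zero, hrw]; exact hw⟩
    | succ m ih =>
      obtain ⟨r', hr', hw', hm⟩ := ih
      refine ⟨_, hr'.prolong, ?_, ?_⟩
      · rw [Function.update_of_ne (by omega), hw']
      · rw [← Nat.add_assoc, Function.update_self]
        exact Submodule.neg_mem _ (C.evol_mem_lamDist hm)
  obtain ⟨r', hr', hw', hm⟩ := hprolong (N + 1)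
  -- A second chain reaches the opposite of the terminal value in `N` steps. Delayed by `N + 1`, it
  -- vanishes up to place `N`, so the sum still has `w` there and ends with zero at `2N + 1`; thus
  -- `p = 2N`.
  obtain ⟨y, hy, hyw⟩ := hN (Submodule.neg_mem _ hm)
  have hchain := hy.delay (N + 1)
  rw [show N + 1 + N = N + (N + 1) by omega] at hchain
  refine ⟨N + N, _, hr'.add hchain, ?_, N, by omega, ?_⟩
  · rw [show N + N + 1 = N + (N + 1) by omega]
    simp only [Pi.add_apply]
    rw [if_neg (by omega), show N + (N + 1) - (N + 1) = N by omega, hyw, add_neg_cancel]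
  · simp [hw']

/-! ### Gauge identities -/

/-- The coefficient identities of a gauge transformation with `δx = ∑ c_k ε⁽ᵏ⁾` and
`δλ = ∑ s_k ε⁽ᵏ⁾`. -/
def GaugeIdentity (c : ℕ → Fin n → K) (s : ℕ → Fin l → K) : Prop :=
  ∀ k, C.evol V Z (c k) + (if k = 0 then 0 else c (k - 1)) = ∑ α, s k α • Z α

variable {C V Z} {c : ℕ → Fin n → K} {s : ℕ → Fin l → K}

theorem GaugeIdentity.eq (h : C.GaugeIdentity V Z c s) (k : ℕ) :
    c k = ∑ α, s (k + 1) α • Z α - C.evol V Z (c (k + 1)) := by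
  have := h (k + 1)
  rw [if_neg (Nat.succ_ne_zero k), Nat.add_sub_cancel] at this
  rw [← this, add_sub_cancel_left]

/-- Downward induction along a gauge transformation. -/
theorem GaugeIdentity.induction {K : Type*} [CommRing K] {n : ℕ} {c : ℕ → Fin n → K} {p : ℕ}
    (hc : ∀ k, p < k → c k = 0) {q : (Fin n → K) → Prop}
    (h0 : q 0) (hstep : ∀ k, q (c (k + 1)) → q (c k)) (k : ℕ) : q (c k) := by
  have : ∀ j k, p < k + j → q (c k) := by
    intro j
    induction j with
    | zero => intro k hk; rw [hc k hk]; exact h0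
    | succ j ih => exact fun k hk => hstep k (ih (k + 1) (by omega))
  exact this (p + 1) k (by omega)

theorem GaugeIdentity.mem_lamDist (h : C.GaugeIdentity V Z c s) {p : ℕ}
    (hc : ∀ k, p < k → c k = 0) (k : ℕ) : c k ∈ C.lamDist V Z := by
  refine GaugeIdentity.induction hc (q := fun w => w ∈ C.lamDist V Z) (Submodule.zero_mem _)
    (fun k hk => ?_) k
  rw [h.eq k]
  exact Submodule.sub_mem _ (C.charDist_le_lamDist (sum_mem_charDist _)) (C.evol_mem_lamDist hk)

/-- A gauge transformation is a terminated chain read backwards, `c_k = r_{p-k}`. The identity at `k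
= p + 1` is `r_0 ∈ 𝒵`, those at `1 ≤ k ≤ p` are the chain conditions, and the one at `k = 0` is the
last chain condition with `r_{p+1} = 0`. The `s_k` are the coefficients of these elements of `𝒵`. -/
theorem exists_gaugeIdentity {p : ℕ} {r : ℕ → Fin n → K} (h : C.IsChain V Z (p + 1) r)
    (hr : r (p + 1) = 0) : ∃ s : ℕ → Fin l → K, (∀ k, p + 1 < k → s k = 0) ∧
      C.GaugeIdentity V Z (fun k => if k ≤ p then r (p - k) else 0) s := by
  have hex : ∀ k, ∃ s : Fin l → K, (p + 1 < k → s = 0) ∧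
      C.evol V Z (if k ≤ p then r (p - k) else 0) +
        (if k = 0 then 0 else if k - 1 ≤ p then r (p - (k - 1)) else 0) = ∑ α, s α • Z α := by
    intro k
    by_cases hk : p + 1 < k
    · refine ⟨0, fun _ => rfl, ?_⟩
      rw [if_neg (by omega), if_neg (by omega), if_neg (by omega), C.isLieDer_evol.map_zero]
      simp
    · have hmem : C.evol V Z (if k ≤ p then r (p - k) else 0) +
          (if k = 0 then 0 else if k - 1 ≤ p then r (p - (k - 1)) else 0) ∈ charDist Z := by
        rcases Nat.lt_or_ge p k with hpk | hpk
        · rw [if_neg (by omega), if_neg (by omega), if_pos (by omega), C.isLieDer_evol.map_zero,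
            zero_add, show p - (k - 1) = 0 by omega]
          exact h.zero_mem
        · have := h.succ_mem (p - k) (by omega)
          rw [add_comm] at this
          rw [if_pos hpk]
          rcases Nat.eq_zero_or_pos k with rfl | hk0
          · rw [if_pos rfl]
            simpa [hr] using this
          · rw [if_neg (by omega), if_pos (by omega),
              show p - (k - 1) = p - k + 1 by omega]
            exact this
      obtain ⟨s, hs⟩ := (Submodule.mem_span_range_iff_exists_fun K).1 hmem
      exact ⟨s, fun h => absurd h hk, hs.symm⟩
  choose s hs hs' using hex
  exact ⟨s, hs, hs'⟩

/-! ### Constraints -/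

/-- The span over `O` plays the role of an ideal: by the Leibniz rule, a derivation that preserves
`O` preserves it as soon as it maps the generators into it. -/
theorem derivation_mem_span {K : Type*} [CommRing K] {O : Subring K} {ι : Type*} {t : ι → K} {d : K → K}
    (hadd : ∀ a b, d (a + b) = d a + d b) (hmul : ∀ a b, d (a * b) = a * d b + b * d a)
    (hO : ∀ a ∈ O, d a ∈ O) (ht : ∀ a, d (t a) ∈ Submodule.span O (Set.range t)) {x : K}
    (hx : x ∈ Submodule.span O (Set.range t)) : d x ∈ Submodule.span O (Set.range t) := by
  induction hx using Submodule.span_induction with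
  | mem x hx => obtain ⟨a, rfl⟩ := hx; exact ht a
  | zero =>
    have : d 0 = 0 := by simpa using hadd 0 0
    rw [this]
    exact Submodule.zero_mem _
  | add x y _ _ hx hy => rw [hadd]; exact Submodule.add_mem _ hx hy
  | smul g x hx hdx =>
    have e : d (g • x) = g • d x + (⟨d g, hO g g.2⟩ : O) • x := by
      change d (g * x) = g * d x + d g * x
      rw [hmul, mul_comm x]
    rw [e]
    exact Submodule.add_mem _ (Submodule.smul_mem _ _ hdx) (Submodule.smul_mem _ _ hx)

theorem lie_mem {O : Subring K} (hX : ∀ i, ∀ a ∈ O, C.X i a ∈ O) {w : Fin n → K}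
    (hw : ∀ i, w i ∈ O) {a : K} (ha : a ∈ O) : C.lie w a ∈ O :=
  O.sum_mem fun i _ => O.mul_mem (hw i) (hX i a ha)

theorem lie_mem_span {O : Subring K} (hX : ∀ i, ∀ a ∈ O, C.X i a ∈ O) {w : Fin n → K}
    (hw : ∀ i, w i ∈ O) {ι : Type*} {t : ι → K}
    (ht : ∀ a, C.lie w (t a) ∈ Submodule.span O (Set.range t)) {x : K}
    (hx : x ∈ Submodule.span O (Set.range t)) : C.lie w x ∈ Submodule.span O (Set.range t) :=
  derivation_mem_span (C.lie_add w) (C.lie_mul w) (fun _ => lie_mem hX hw) ht hx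

/-- Gauge transformations with coefficients in a differential subring `O` preserve the ideal of
constraints over `O`. -/
theorem GaugeIdentity.lie_mem_span (h : C.GaugeIdentity V Z c s) {p : ℕ}
    (hc : ∀ k, p < k → c k = 0) {O : Subring K} (hX : ∀ i, ∀ a ∈ O, C.X i a ∈ O)
    (hT : ∀ a ∈ O, C.T a ∈ O) (hlam : ∀ α, C.lam 0 α ∈ O) (hV : ∀ i, V i ∈ O)
    (hZ : ∀ α i, Z α i ∈ O) (hcO : ∀ k i, c k i ∈ O) (hsO : ∀ k α, s k α ∈ O) {ι : Type*}
    {t : ι → K} (ht : ∀ a, C.T (t a) = 0)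
    (hVt : ∀ a, C.lie V (t a) ∈ Submodule.span O (Set.range t))
    (hZt : ∀ α a, C.lie (Z α) (t a) ∈ Submodule.span O (Set.range t)) (k : ℕ) (a : ι) :
    C.lie (c k) (t a) ∈ Submodule.span O (Set.range t) := by
  have hsum : ∀ f : Fin l → K, (∀ α, f α ∈ O) → ∀ a,
      C.lie (∑ α, f α • Z α) (t a) ∈ Submodule.span O (Set.range t) := by
    intro f hf a
    rw [lie_sum_left]
    refine Submodule.sum_mem _ fun α _ => ?_
    rw [lie_smul_left]
    exact Submodule.smul_mem _ (⟨f α, hf α⟩ : O) (hZt α a)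
  have hvO : ∀ i, C.vel V Z i ∈ O := by
    intro i
    simp only [vel, Pi.add_apply, Finset.sum_apply, Pi.smul_apply, smul_eq_mul]
    exact O.add_mem (hV i) (O.sum_mem fun α _ => O.mul_mem (hlam α) (hZ α i))
  have hvt : ∀ a, C.lie (C.vel V Z) (t a) ∈ Submodule.span O (Set.range t) := by
    intro a
    rw [vel, lie_add_left]
    exact Submodule.add_mem _ (hVt a) (hsum _ hlam a)
  refine GaugeIdentity.induction hc
    (q := fun w => ∀ a, C.lie w (t a) ∈ Submodule.span O (Set.range t)) ?_ ?_ k a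
  · intro a
    rw [lie_zero_left]
    exact Submodule.zero_mem _
  · intro k ih a
    -- With `v` the velocity and `c = c_{k+1}`, the field `E c` acts on `t` as `∂(c t) + v(c t) -
    -- c(v t)`, because `∂t = 0`. Each term lies in the span: `c t` by induction, `v t` by tangency.
    rw [h.eq k, sub_eq_add_neg, lie_add_left, lie_neg_left, ← sub_eq_add_neg, evol, lie_add_left,
      lie_br]
    have e : C.lie (comp C.T (c (k + 1))) (t a) = C.T (C.lie (c (k + 1)) (t a)) := by
      have h0 : C.lie (c (k + 1)) 0 = 0 := by simp [lie]
      rw [C.lie_comp C.X_T, ht, h0, add_zero]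
    rw [e]
    refine Submodule.sub_mem _ (hsum _ (hsO (k + 1)) a) (Submodule.add_mem _ ?_
      (Submodule.sub_mem _ (JetCalculus.lie_mem_span hX hvO hvt (ih a))
        (JetCalculus.lie_mem_span hX (hcO (k + 1)) ih (hvt a))))
    refine derivation_mem_span (map_add C.T) (fun a b => C.T.leibniz a b) hT (fun b => ?_) (ih a)
    rw [ht]
    exact Submodule.zero_mem _

/-! ### The on-shell variation of the equations -/

/-- The product rule, read coefficientwise. The case `k = 0` is separated because truncated
subtraction would give `0 - 1 = 0`. -/
theorem epsTimeDeriv_apply {K : Type*} [CommRing K] (d : K → K) (hd0 : d 0 = 0) (hd : ∀ a b, d (a + b) = d a + d b)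
    (c : ℕ →₀ K) (k : ℕ) :
    (c.sum fun k a => Finsupp.single k (d a) + Finsupp.single (k + 1) a) k =
      d (c k) + if k = 0 then 0 else c (k - 1) := by
  induction c using Finsupp.induction_linear with
  | zero => simp [hd0]
  | add f g hf hg =>
    rw [Finsupp.sum_add_index' (by simp [hd0])
      (by intro i a b; rw [hd, Finsupp.single_add, Finsupp.single_add]; abel),
      Finsupp.add_apply, hf, hg, Finsupp.add_apply, hd]
    split_ifs
    · abel
    · rw [Finsupp.add_apply]; abel
  | single j a =>
    rw [Finsupp.sum_single_index (by simp [hd0]), Finsupp.add_apply]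
    congr 1
    · by_cases h : j = k
      · subst h; simp
      · simp [h, hd0]
    · rcases k with _ | k
      · simp
      · simp [Finsupp.single_apply]

/-- The derivative of `δx` along the velocity and the variation of the right hand side combine into
the commutator of the velocity with the coefficient, which together with `∂` is `E`. -/
theorem gaugeIdentity_iff (dx : Fin n → ℕ →₀ K) (dl : Fin l → ℕ →₀ K) :
    (∀ i, ((dx i).sum fun k a =>
        Finsupp.single k (C.T a + C.lie (C.vel V Z) a) + Finsupp.single (k + 1) a)
      - ∑ j, C.X j (C.vel V Z i) • dx j - ∑ α, Z α i • dl α = 0) ↔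
    C.GaugeIdentity V Z (fun k i => dx i k) (fun k α => dl α k) := by
  have key : ∀ i k, (((dx i).sum fun k a =>
        Finsupp.single k (C.T a + C.lie (C.vel V Z) a) + Finsupp.single (k + 1) a)
      - ∑ j, C.X j (C.vel V Z i) • dx j - ∑ α, Z α i • dl α) k =
      (C.evol V Z (fun i => dx i k) + (if k = 0 then 0 else fun i => dx i (k - 1)) -
        ∑ α, dl α k • Z α) i := by
    intro i k
    rw [Finsupp.sub_apply, Finsupp.sub_apply,
      epsTimeDeriv_apply (fun a => C.T a + C.lie (C.vel V Z) a) (by simp [lie])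
        (by intro a b; rw [map_add, lie_add]; abel)]
    simp only [Finsupp.finsetSum_apply, Finsupp.smul_apply, Pi.sub_apply, Pi.add_apply, evol, comp,
      br_apply, Finset.sum_apply, Pi.smul_apply, smul_eq_mul]
    have e₁ : C.lie (fun i => dx i k) (C.vel V Z i) = ∑ j, C.X j (C.vel V Z i) * dx j k :=
      Finset.sum_congr rfl fun j _ => mul_comm _ _
    have e₂ : (if k = 0 then 0 else fun i => dx i (k - 1) : Fin n → K) i =
        if k = 0 then 0 else dx i (k - 1) := by
      split_ifs <;> rfl
    have e₃ : ∑ α, dl α k * Z α i = ∑ α, Z α i * dl α k :=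
      Finset.sum_congr rfl fun α _ => mul_comm _ _
    rw [e₁, e₂, e₃]
    ring
  constructor
  · intro h k
    rw [← sub_eq_zero]
    funext i
    rw [← key, h i]
    rfl
  · intro h i
    refine Finsupp.ext fun k => ?_
    rw [key, h k, sub_self]
    rfl

end JetCalculus

theorem mem_span_of_eq_sum {K ι : Type*} [CommRing K] [Fintype ι] {O : Subring K} {t F : ι → K}
    {x : K} (hF : ∀ b, F b ∈ O) (hx : x = ∑ b, F b * t b) :
    x ∈ Submodule.span O (Set.range t) :=
  (Submodule.mem_span_range_iff_exists_fun O).2 ⟨fun b => ⟨F b, hF b⟩, hx.symm⟩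

/-! ### Values of fractions -/

section Values

variable {A : Type*} [CommRing A] {ev : A →+* ℝ} {a b : FractionRing A} {r s : ℝ}

theorem fractionHasValue_algebraMap (ev : A →+* ℝ) (f : A) :
    FractionHasValue ev (algebraMap A (FractionRing A) f) (ev f) :=
  ⟨f, 1, by simp, by simp, by simp⟩

theorem FractionHasValue.add (ha : FractionHasValue ev a r) (hb : FractionHasValue ev b s) :
    FractionHasValue ev (a + b) (r + s) := by
  obtain ⟨f, g, hg, e, rfl⟩ := ha
  obtain ⟨f', g', hg', e', rfl⟩ := hb
  refine ⟨f * g' + f' * g, g * g', by simp [hg, hg'], ?_, ?_⟩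
  · simp only [map_add, map_mul, ← e, ← e']
    ring
  · simp only [map_add, map_mul]
    field_simp

theorem FractionHasValue.mul (ha : FractionHasValue ev a r) (hb : FractionHasValue ev b s) :
    FractionHasValue ev (a * b) (r * s) := by
  obtain ⟨f, g, hg, e, rfl⟩ := ha
  obtain ⟨f', g', hg', e', rfl⟩ := hb
  refine ⟨f * f', g * g', by simp [hg, hg'], ?_, ?_⟩
  · simp only [map_mul, ← e, ← e']
    ring
  · simp only [map_mul]
    field_simp

theorem FractionHasValue.sum {ι : Type*} {t : Finset ι} {a : ι → FractionRing A} {r : ι → ℝ}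
    (h : ∀ i ∈ t, FractionHasValue ev (a i) (r i)) :
    FractionHasValue ev (∑ i ∈ t, a i) (∑ i ∈ t, r i) := by
  classical
  induction t using Finset.induction_on with
  | empty => simpa using fractionHasValue_algebraMap ev 0
  | insert i t hi ih =>
    rw [Finset.sum_insert hi, Finset.sum_insert hi]
    exact (h i (Finset.mem_insert_self i t)).add
      (ih fun j hj => h j (Finset.mem_insert_of_mem hj))

/-- The fractions that are regular at a point. -/
def regularFractions (ev : A →+* ℝ) : Subring (FractionRing A) where
  carrier := {a | ∃ r, FractionHasValue ev a r}
  mul_mem' := fun ⟨_, ha⟩ ⟨_, hb⟩ => ⟨_, ha.mul hb⟩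
  one_mem' := ⟨_, by simpa using fractionHasValue_algebraMap ev 1⟩
  add_mem' := fun ⟨_, ha⟩ ⟨_, hb⟩ => ⟨_, ha.add hb⟩
  zero_mem' := ⟨_, by simpa using fractionHasValue_algebraMap ev 0⟩
  neg_mem' := by
    rintro a ⟨_, f, g, hg, e, rfl⟩
    exact ⟨_, -f, g, hg, by simp [e], rfl⟩

theorem fractionDerivation_mem_regularFractions [Algebra ℝ A] (d : Derivation ℝ A A)
    (ha : a ∈ regularFractions ev) : fractionDerivation d a ∈ regularFractions ev := by
  obtain ⟨_, f, g, hg, e, rfl⟩ := ha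
  refine ⟨_, d f * g - f * d g, g * g, by simp [hg], ?_, rfl⟩
  have h := congrArg (fractionDerivation d) e
  rw [Derivation.leibniz, fractionDerivation_algebraMap, fractionDerivation_algebraMap,
    smul_eq_mul, smul_eq_mul] at h
  rw [map_sub, map_mul, map_mul, map_mul, ← e, ← h]
  ring

/-- A combination of functions that vanish at a point, with coefficients that are regular there,
vanishes at this point. -/
theorem fractionHasValue_of_mem_span {m : ℕ} {t : Fin m → FractionRing A}
    (ht : ∀ b, FractionHasValue ev (t b) 0)
    (ha : a ∈ Submodule.span (regularFractions ev) (Set.range t)) : FractionHasValue ev a 0 := by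
  obtain ⟨G, rfl⟩ := (Submodule.mem_span_range_iff_exists_fun (regularFractions ev)).1 ha
  choose r hr using fun b => (G b).2
  have h := FractionHasValue.sum (t := Finset.univ) (a := fun b => G b • t b)
    (r := fun b => r b * 0) fun b _ => (hr b).mul (ht b)
  simpa using h

end Values

/-! ### The calculus of meromorphic functions -/

section Meromorphic

variable {n l : ℕ} (U : PhaseDomain n)

/-- The calculus on the ring of analytic functions. -/
def ringCalculus (l : ℕ) : JetCalculus (jetRing U l) n l where
  X := ringPartialX U l
  T := ringPartialT U l
  L := ringPartialLam U
  lam := ringLam U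
  X_comm := ringPartialX_comm
  X_T := ringPartialX_ringPartialT
  X_L := ringPartialX_ringPartialLam
  L_zero_T := ringPartialLam_zero_ringPartialT
  L_succ_T := ringPartialLam_succ_ringPartialT
  X_lam := ringPartialX_ringLam
  L_lam := ringPartialLam_ringLam
  exists_order f := by
    obtain ⟨N, hN⟩ := exists_hasOrderLE f
    exact ⟨N, fun M hM => ⟨fun α => hN.ringPartialLam_eq_zero hM α, (hN.mono hM).ringPartialT_eq⟩⟩

/-- The calculus on the field of meromorphic functions. -/
def fieldCalculus (l : ℕ) : JetCalculus (JetField U l) n l := (ringCalculus U l).fractions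

/-- For a domain the fraction ring is a field. Connectedness of `U` enters here, through
`jetRing_isDomain`, and yields the finiteness used for generators and for the stabilisation of
chains. -/
theorem isNoetherianRing_fractionRing (A : Type*) [CommRing A] [IsDomain A] :
    IsNoetherianRing (FractionRing A) := inferInstance

instance (l : ℕ) : IsNoetherianRing (JetField U l) := isNoetherianRing_fractionRing _

variable {U}

theorem baseInclusion_algebraMap (f : analyticRing U) :
    baseInclusion U l (algebraMap _ _ f) = algebraMap _ _ (pullback U l f) := by
  unfold baseInclusion IsFractionRing.map
  exact IsLocalization.map_eq _ _

theorem fractionDerivation_baseInclusion {d : Derivation ℝ (jetRing U l) (jetRing U l)}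
    (h : ∀ f, d (pullback U l f) = 0) (a : BaseField U) :
    fractionDerivation d (baseInclusion U l a) = 0 := by
  obtain ⟨⟨f, g⟩, hx⟩ := IsLocalization.surj (nonZeroDivisors (analyticRing U)) a
  -- The pulled-back denominator is invertible as the image of an invertible element under a ring
  -- homomorphism.
  have hu : IsUnit (algebraMap (jetRing U l) (FractionRing (jetRing U l)) (pullback U l g)) := by
    rw [← baseInclusion_algebraMap]
    exact (IsLocalization.map_units (BaseField U) g).map (baseInclusion U l)
  have hx' := congrArg (baseInclusion U l) hx
  rw [map_mul, baseInclusion_algebraMap, baseInclusion_algebraMap] at hx'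
  refine derivation_eq_of_mul_eq (d' := 0) hu hx' ?_ ?_
  · rw [fractionDerivation_algebraMap, h, map_zero, Derivation.zero_apply]
  · rw [fractionDerivation_algebraMap, h, map_zero, Derivation.zero_apply]

theorem isConst_toJet (v : BaseVectorField U) : (fieldCalculus U l).IsConst (v.toJet l) where
  T_eq i := fractionDerivation_baseInclusion ringPartialT_pullback (v i)
  L_eq k α i := fractionDerivation_baseInclusion (ringPartialLam_pullback k α) (v i)

theorem BaseHasValue.toJet {a : BaseField U} {r : ℝ} {q : JetPoint U l}
    (h : BaseHasValue q.1 a r) : JetHasValue q (baseInclusion U l a) r := by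
  obtain ⟨f, g, hg, e, rfl⟩ := h
  refine ⟨pullback U l f, pullback U l g, hg, ?_, rfl⟩
  rw [← baseInclusion_algebraMap, ← baseInclusion_algebraMap, ← e, map_mul]

end Meromorphic

/-! ### Gauge transformations -/

theorem sum_single_apply {M : Type*} [AddCommMonoid M] (N : ℕ) (f : Fin N → M) (k : ℕ) :
    (∑ j : Fin N, Finsupp.single (j : ℕ) (f j)) k = if h : k < N then f ⟨k, h⟩ else 0 := by
  rw [Finsupp.finsetSum_apply]
  split_ifs with h
  · rw [Finset.sum_eq_single ⟨k, h⟩]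
    · simp
    · intro j _ hj
      exact Finsupp.single_eq_of_ne fun e => hj (Fin.ext e.symm)
    · simp
  · exact Finset.sum_eq_zero fun j _ => Finsupp.single_eq_of_ne (by omega)

namespace Transformation

variable {n l p : ℕ} {U : PhaseDomain n} (τ : Transformation U l p)

/-- The coefficient of `δx` at the `k`-th derivative of `ε`. -/
def coeffX (k : ℕ) : JetVectorField U l := fun i => τ.deltaX i k

/-- The coefficient of `δλ` at the `k`-th derivative of `ε`. -/
def coeffLam (k : ℕ) : Fin l → JetField U l := fun α => τ.deltaLam α k

theorem coeffX_apply (k : ℕ) (i : Fin n) :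
    τ.coeffX k i = if h : k < p + 1 then τ.R (Fin.rev ⟨k, h⟩) i else 0 :=
  sum_single_apply (p + 1) (fun k => τ.R k.rev i) k

theorem coeffLam_apply (k : ℕ) (α : Fin l) :
    τ.coeffLam k α = if h : k < p + 2 then τ.S (Fin.rev ⟨k, h⟩) α else 0 :=
  sum_single_apply (p + 2) (fun k => τ.S k.rev α) k

theorem coeffX_eq_zero {k : ℕ} (hk : p < k) : τ.coeffX k = 0 := by
  funext i
  rw [coeffX_apply, dif_neg (by omega)]
  rfl

theorem coeffX_rev (k : Fin (p + 1)) : τ.coeffX k.rev = τ.R k := by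
  funext i
  rw [coeffX_apply, dif_pos k.rev.2]
  exact congrArg (fun j => τ.R j i) (Fin.rev_rev k)

theorem isGauge_iff (V : BaseVectorField U) (Z : Fin l → BaseVectorField U) :
    τ.IsGauge V Z ↔ (fieldCalculus U l).GaugeIdentity (V.toJet l) (fun α => (Z α).toJet l)
      τ.coeffX τ.coeffLam :=
  (fieldCalculus U l).gaugeIdentity_iff τ.deltaX τ.deltaLam

theorem deltaFun_apply (T : BaseField U) (k : ℕ) :
    τ.deltaFun T k = (fieldCalculus U l).lie (τ.coeffX k) (baseInclusion U l T) := by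
  rw [deltaFun, Finsupp.finsetSum_apply]
  exact Finset.sum_congr rfl fun j _ => mul_comm _ _

end Transformation

/-! ### The three assertions for meromorphic vector fields -/

section Main

variable {n l : ℕ} {U : PhaseDomain n} {V : BaseVectorField U} {Z : Fin l → BaseVectorField U}

/-- The operations of `fieldCalculus` unfold to `dX`, `dT` and `lamVar`, so the abstract and the
concrete distributions agree by definition. -/
theorem lambdaDistribution_eq :
    lambdaDistribution V Z =
      (fieldCalculus U l).lamDist (V.toJet l) (fun α => (Z α).toJet l) := rfl

theorem gaugeDistribution_eq :
    gaugeDistribution V Z =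
      (fieldCalculus U l).gaugeDist (V.toJet l) (fun α => (Z α).toJet l) := rfl

theorem lambdaDistribution_eq_gaugeDistribution :
    lambdaDistribution V Z = gaugeDistribution V Z := by
  rw [lambdaDistribution_eq, gaugeDistribution_eq]
  exact JetCalculus.lamDist_eq_gaugeDist _ (isConst_toJet V) fun α => isConst_toJet (Z α)

theorem Transformation.R_mem_lambdaDistribution {p : ℕ} {τ : Transformation U l p}
    (h : τ.IsGauge V Z) (k : Fin (p + 1)) : τ.R k ∈ lambdaDistribution V Z := by
  rw [← τ.coeffX_rev]
  exact ((τ.isGauge_iff V Z).1 h).mem_lamDist (fun _ => τ.coeffX_eq_zero) _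

theorem exists_isGauge {w : JetVectorField U l} (hw : w ∈ lambdaDistribution V Z) :
    ∃ (p : ℕ) (τ : Transformation U l p), τ.IsGauge V Z ∧ ∃ k, w = τ.R k := by
  obtain ⟨p, r, hr, hr0, k, hk, rfl⟩ :=
    (fieldCalculus U l).exists_chain (V.toJet l) (fun α => (Z α).toJet l) hw
  obtain ⟨s, hs, hg⟩ := JetCalculus.exists_gaugeIdentity hr hr0
  -- The chain is already indexed like `R`, whereas `s` is indexed by the order of the derivative of
  -- `ε` and has to be reversed.
  let τ : Transformation U l p := ⟨fun j => r j, fun j => s (p + 1 - j)⟩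
  refine ⟨p, τ, ?_, ⟨k, by omega⟩, rfl⟩
  rw [τ.isGauge_iff]
  have hX : τ.coeffX = fun k => if k ≤ p then r (p - k) else 0 := by
    funext k i
    rw [τ.coeffX_apply]
    by_cases h : k ≤ p
    · rw [dif_pos (by omega), if_pos h]
      simp [τ]
    · rw [dif_neg (by omega), if_neg h]
      rfl
  have hL : τ.coeffLam = s := by
    funext k α
    rw [τ.coeffLam_apply]
    by_cases h : k < p + 2
    · rw [dif_pos h]
      have : p + 1 - (p + 2 - (k + 1)) = k := by omega
      simp only [τ, Fin.val_rev, this]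
    · rw [dif_neg h, hs k (by omega)]
      rfl
  rw [hX, hL]
  exact hg

theorem deltaFun_hasValue_zero {m : ℕ} {T : Fin m → BaseField U} {O : Set U.carrier}
    (hN : IsCompleteNormalForm V Z T O) {p : ℕ} {τ : Transformation U l p} (hτ : τ.IsGauge V Z)
    {q : JetPoint U l} (hq : q.1 ∈ constraintSurface T O) (hreg : τ.RegularAt q) (a : Fin m)
    (k : ℕ) : JetHasValue q (τ.deltaFun (T a) k) 0 := by
  obtain ⟨hqO, hqT⟩ := hq
  rw [τ.deltaFun_apply]
  refine fractionHasValue_of_mem_span (t := fun b => baseInclusion U l (T b))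
    (fun b => (hqT b).toJet) ?_
  have htoJet : ∀ {b : BaseField U}, BaseRegularAt q.1 b →
      JetRegularAt q (baseInclusion U l b) := fun ⟨r, hr⟩ => ⟨r, hr.toJet⟩
  -- The differential subring is that of the fractions regular at `q`: by the quotient rule
  -- derivatives only square the denominator, which stays nonzero at `q`.
  refine ((τ.isGauge_iff V Z).1 hτ).lie_mem_span (fun _ => τ.coeffX_eq_zero)
    (fun i _ => fractionDerivation_mem_regularFractions (ringPartialX U l i))
    (fun _ => fractionDerivation_mem_regularFractions (ringPartialT U l))
    (fun α => ⟨_, fractionHasValue_algebraMap _ (ringLam U 0 α)⟩)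
    (fun i => htoJet (hN.regular_V _ hqO i)) (fun α i => htoJet (hN.regular_Z _ hqO α i))
    ?_ ?_ (fun b => fractionDerivation_baseInclusion ringPartialT_pullback (T b)) ?_ ?_ k a
  · intro k i
    rw [τ.coeffX_apply]
    split_ifs
    · exact hreg.1 _ _
    · exact Subring.zero_mem _
  · intro k α
    rw [τ.coeffLam_apply]
    split_ifs
    · exact hreg.2 _ _
    · exact Subring.zero_mem _
  · obtain ⟨F, hF, e⟩ := hN.tangent_V
    intro b
    exact mem_span_of_eq_sum (fun c => htoJet (hF _ hqO b c)) (e b)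
  · obtain ⟨F, hF, e⟩ := hN.tangent_Z
    intro α b
    exact mem_span_of_eq_sum (fun c => htoJet (hF _ hqO α b c)) (e α b)

end Main

end LocalDynamics

end

theorem proposition3 (n l : ℕ) (U : PhaseDomain n) (V : BaseVectorField U)
    (Z : Fin l → BaseVectorField U) :
    -- `𝒵_D = 𝒵_V`
    lambdaDistribution V Z = gaugeDistribution V Z ∧
    -- the coefficients of the `x`-variations of all gauge transformations span `𝒵_V`
    Submodule.span (JetField U l) {w : JetVectorField U l | ∃ (p : ℕ) (τ : Transformation U l p),
      τ.IsGauge V Z ∧ ∃ k, w = τ.R k} = gaugeDistribution V Z ∧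
    -- the gauge transformations preserve the constraints of a complete normal form
    ∀ (m : ℕ) (T : Fin m → BaseField U) (O : Set U.carrier), IsCompleteNormalForm V Z T O →
      ∀ (p : ℕ) (τ : Transformation U l p), τ.IsGauge V Z →
        ∀ q : JetPoint U l, q.1 ∈ constraintSurface T O → τ.RegularAt q →
          ∀ (a : Fin m) (k : ℕ), JetHasValue q (τ.deltaFun (T a) k) 0 := by
  refine ⟨lambdaDistribution_eq_gaugeDistribution, ?_, ?_⟩
  · rw [← lambdaDistribution_eq_gaugeDistribution]
    refine le_antisymm (Submodule.span_le.2 ?_) fun w hw => Submodule.subset_span (exists_isGauge hw)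
    rintro _ ⟨p, τ, hτ, k, rfl⟩
    exact Transformation.R_mem_lambdaDistribution hτ k
  · intro m T O hN p τ hτ q hq hreg a k
    exact deltaFun_hasValue_zero hN hτ hq hreg a k
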